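/- Let $K$ be an algebraically closed field of characteristic $0$. A variety over $K$ is an integral separated scheme of finite type over $K$; subvarieties are closed and irreducible (with their reduced structure). Let $\mathfrak{C}$ be a category with a functor $\mathcal{F}$ to the category of varieties over $K$; objects and morphisms of $\mathfrak{C}$ are called distinguished varieties and distinguished morphisms and are identified with their images under $\mathcal{F}$ where convenient. Assume that $\mathfrak{C}$ is a distinguished category, i.e. that the following axioms hold. (A1) For all distinguished varieties $X,Y$ there are a distinguished variety $X\times Y$ and distinguished morphisms $\pi_X: X\times Y\to X$, $\pi_Y: X\times Y\to Y$ inducing an isomorphism $\mathcal{F}(X\times Y)\simeq \mathcal{F}(X)\times_K\mathcal{F}(Y)$, and such that for all distinguished morphisms $\phi:W\to X$, $\psi: W\to Y$ there is a distinguished morphism $\chi: W\to X\times Y$ with $\pi_X\circ\chi=\phi$, $\pi_Y\circ\chi=\psi$. (A2) For all distinguished morphisms $\phi:X\to Z$, $\psi:Y\to Z$ there are finitely many distinguished morphisms $\phi_i: X_i\to X\times Y$ ($1\le i\le n$, $n\geq 0$) with $\bigcup_{i=1}^n\mathcal{F}(\phi_i)(\mathcal{F}(X_i))=(\mathcal{F}(X)\times_{\mathcal{F}(Z)}\mathcal{F}(Y))_{\mathrm{red}}\subset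 \mathcal{F}(X)\times_K\mathcal{F}(Y)$. (A3) $\mathfrak{C}$ has a final object, which is mapped to $\operatorname{Spec} K$ by $\mathcal{F}$. (A4) For every distinguished morphism $\phi:X\to Y$ the image $\mathcal{F}(\phi)(\mathcal{F}(X))$ is closed in $\mathcal{F}(Y)$, and there are distinguished morphisms $\phi_1:W\to X$, $\phi_2:W\to Z$, $\phi_3:Z\to Y$ such that $\phi\circ\phi_1=\phi_3\circ\phi_2$, $\mathcal{F}(\phi_1)$ is finite and surjective, $\mathcal{F}(\phi_3)$ has finite fibers, $\mathcal{F}(\phi_2)^{-1}(z)$ is irreducible for all $z\in\mathcal{F}(\phi_2)(\mathcal{F}(W))$, and $\dim_w\mathcal{F}(\phi_2)^{-1}(\mathcal{F}(\phi_2)(w))$ is constant for $w\in\mathcal{F}(W)$. A subvariety of a distinguished variety $X$ is special if it is the image of a distinguished morphism, and weakly special if it is an irreducible component of $\phi(\psi^{-1}(y))$ for some distinguished morphisms $\psi:Z\to Y$, $\phi:Z\to X$ and some $y\in Y(K)$. For a subvariety $V\subset X$ let $\langle V\rangle$ (resp. $\langle V\rangle_{\mathrm{ws}}$) be the smallest special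 (resp. weakly special) subvariety of $X$ containing $V$ (these exist), and put $\delta(V)=\dim\langle V\rangle-\dim V$ and $\delta_{\mathrm{ws}}(V)=\dim\langle V\rangle_{\mathrm{ws}}-\dim V$. A subvariety $W\subset V$ is optimal (resp. weakly optimal) for $V$ in $X$ if $\delta(U)>\delta(W)$ (resp. $\delta_{\mathrm{ws}}(U)>\delta_{\mathrm{ws}}(W)$) for every subvariety $U$ with $W\subsetneq U\subset V$. Assume moreover that $\mathfrak{C}$ satisfies (A5) For every distinguished variety $X$ and every subvariety $V\subset X$ there is a finite set of pairs $(\phi,\psi)$ of distinguished morphisms $\phi:Y_\phi\to X$, $\psi:Y_\phi\to Z_\psi$ such that for every $W$ weakly optimal for $V$ in $X$ there are a pair $(\phi,\psi)$ in this set and $z\in Z_\psi(K)$ such that $\phi$ has finite fibers and $\langle W\rangle_{\mathrm{ws}}$ is an irreducible component of $\phi(\psi^{-1}(z))$. For an integer $k$ let $X^{[k]}$ be the union of all special subvarieties of $X$ of codimension at least $k$ (so $X^{[k]}=\emptyset$ if $k>\dim X$). Let $m,d$ be non-negative integers. Then the following are equivalent: (Zilber) for every distinguished variety $X$, $\mathrm{ZP}(X,m,d)$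 holds, i.e. every subvariety of $X$ of dimension at most $m$ contains at most finitely many subvarieties that are optimal for it in $X$ and have defect $\delta$ at most $d$; (Pink) for every distinguished variety $X$ and every subvariety $V\subset X$ of dimension at most $m$, the set $V\cap X^{[\dim X-\min\{\delta(V)-1,d\}]}$ is not Zariski dense in $V$. -/

import Mathlib

open CategoryTheory Limits AlgebraicGeometry TopologicalSpace

universe u v w

noncomputable section

namespace UnlikelyIntersections

/-! ### Varieties and dimension -/

section Varieties

variable (K : Type u) [Field K]

/-- A `K`-scheme is a variety if it is integral (so in particular irreducible and non-empty),
separated and of finite type over `K`. -/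
def isVariety : ObjectProperty (Over (Spec (CommRingCat.of K))) := fun X =>
  IsIntegral X.left ∧ IsSeparated X.hom ∧ LocallyOfFiniteType X.hom ∧ QuasiCompact X.hom

/-- The category of varieties over `K` (with morphisms of `K`-schemes). -/
abbrev VarietyCat : Type (u + 1) := (isVariety K).FullSubcategory

end Varieties

/-- The dimension of a (finite-dimensional) subset of a topological space, as a natural number. -/
def dim {T : Type u} [TopologicalSpace T] (S : Set T) : ℕ :=
  ((topologicalKrullDim S).unbotD 0).toNat

/-- The local dimension `dim_x T` of a topological space `T` at the point `x`: the infimum of the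
dimensions of the open neighbourhoods of `x`. -/
def localDim {T : Type u} [TopologicalSpace T] (x : T) : WithBot ℕ∞ :=
  ⨅ U : OpenNhdsOf x, topologicalKrullDim (U : Set T)

/-- `W` is an irreducible component of the subset `S`. -/
def IsComponentOf {T : Type u} [TopologicalSpace T] (W S : Set T) : Prop :=
  Maximal (fun U : Set T => IsIrreducible U ∧ U ⊆ S) W

/-- All (set-theoretic) fibers of the morphism `f` are finite. -/
def HasFiniteFibers {X Y : Scheme.{u}} (f : X ⟶ Y) : Prop :=
  ∀ y : Y, (f ⁻¹' {y}).Finite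

/-! ### Distinguished categories -/

section Categories

variable {K : Type u} [Field K] {C : Type v} [Category.{w} C] (F : C ⥤ VarietyCat K)

/-- The underlying scheme of the variety `F(X)`. -/
abbrev var (X : C) : Scheme.{u} := (F.obj X).obj.left

/-- The structure morphism `F(X) ⟶ Spec K`. -/
abbrev str (X : C) : var F X ⟶ Spec (CommRingCat.of K) := (F.obj X).obj.hom

/-- The morphism of schemes underlying `F(φ)`. -/
abbrev mor {X Y : C} (φ : X ⟶ Y) : var F X ⟶ var F Y := (F.map φ).hom.left

theorem mor_str {X Y : C} (φ : X ⟶ Y) : mor F φ ≫ str F Y = str F X :=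
  Over.w (F.map φ).hom

/-- `P` with `pX : P ⟶ X` and `pY : P ⟶ Y` is a direct product of `X` and `Y` in the sense
of distinguished categories: `F(P)` is identified with `F(X) ×_K F(Y)` through `F(pX)` and `F(pY)`,
and any two morphisms `W ⟶ X`, `W ⟶ Y` are induced by a morphism `W ⟶ P`. -/
structure IsDirectProduct {X Y P : C} (pX : P ⟶ X) (pY : P ⟶ Y) : Prop where
  isPullback : IsPullback (mor F pX) (mor F pY) (str F X) (str F Y)
  exists_lift : ∀ (W : C) (φ : W ⟶ X) (ψ : W ⟶ Y), ∃ χ : W ⟶ P, χ ≫ pX = φ ∧ χ ≫ pY = ψ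

variable {F} in
/-- The canonical morphism from `F(X) ×_{F(Z)} F(Y)` to `F(P) = F(X) ×_K F(Y)`. -/
def IsDirectProduct.fromFiberProduct {X Y P : C} {pX : P ⟶ X} {pY : P ⟶ Y}
    (h : IsDirectProduct F pX pY) {Z : C} (φ : X ⟶ Z) (ψ : Y ⟶ Z) :
    pullback (mor F φ) (mor F ψ) ⟶ var F P :=
  h.isPullback.lift (pullback.fst (mor F φ) (mor F ψ)) (pullback.snd (mor F φ) (mor F ψ)) (by
    rw [← mor_str F φ, ← mor_str F ψ, ← Category.assoc, ← Category.assoc, pullback.condition])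

/-- A category `C` with a functor `F` to the varieties over `K` is a distinguished category if
it satisfies the axioms (A1) Direct Products, (A2) Fibered Products, (A3) Final Object and
(A4) Fiber Dimension. -/
structure IsDistinguished : Prop where
  /-- (A1) -/
  directProducts : ∀ X Y : C, ∃ (P : C) (pX : P ⟶ X) (pY : P ⟶ Y), IsDirectProduct F pX pY
  /-- (A2): `(F(X) ×_{F(Z)} F(Y))_red`, as a subset of `F(X) ×_K F(Y)`, is a finite union of images
  of distinguished morphisms. -/
  fiberedProducts : ∀ (X Y Z : C) (φ : X ⟶ Z) (ψ : Y ⟶ Z) (P : C) (pX : P ⟶ X) (pY : P ⟶ Y)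
    (h : IsDirectProduct F pX pY), ∃ (n : ℕ) (A : Fin n → C) (f : ∀ i, A i ⟶ P),
      ⋃ i, Set.range (mor F (f i)) = Set.range (h.fromFiberProduct φ ψ)
  /-- (A3) -/
  finalObject : ∃ T : C, Nonempty (IsTerminal T) ∧ IsIso (str F T)
  /-- (A4), first part -/
  isClosed_range : ∀ (X Y : C) (φ : X ⟶ Y), IsClosed (Set.range (mor F φ))
  /-- (A4), second part -/
  fiberDimension : ∀ (X Y : C) (φ : X ⟶ Y),
    ∃ (W Z : C) (φ₁ : W ⟶ X) (φ₂ : W ⟶ Z) (φ₃ : Z ⟶ Y), φ₁ ≫ φ = φ₂ ≫ φ₃ ∧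
      IsFinite (mor F φ₁) ∧ Surjective (mor F φ₁) ∧
      HasFiniteFibers (mor F φ₃) ∧
      (∀ z ∈ Set.range (mor F φ₂), IsIrreducible (mor F φ₂ ⁻¹' {z})) ∧
      ∀ w w' : var F W,
        localDim (T := (mor F φ₂ ⁻¹' {mor F φ₂ w} : Set (var F W))) ⟨w, rfl⟩ =
          localDim (T := (mor F φ₂ ⁻¹' {mor F φ₂ w'} : Set (var F W))) ⟨w', rfl⟩

/-! ### Special and weakly special subvarieties -/

/-- The subvarieties of a distinguished variety: its irreducible closed subsets (with their reduced
structure). -/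
abbrev Subvar (X : C) : Type u := IrreducibleCloseds (var F X)

variable {F} {X : C}

/-- A subvariety is special if it is the image of a distinguished morphism. -/
def IsSpecial (V : Subvar F X) : Prop :=
  ∃ (Y : C) (φ : Y ⟶ X), (V : Set (var F X)) = Set.range (mor F φ)

/-- A subvariety is weakly special if it is an irreducible component of `φ(ψ⁻¹(y))` for
distinguished morphisms `ψ : Z ⟶ Y`, `φ : Z ⟶ X` and `y ∈ Y(K)`. As `K` will be algebraically
closed, `Y(K)` is the set of closed points of `Y`. -/
def IsWeaklySpecial (V : Subvar F X) : Prop :=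
  ∃ (Z Y : C) (ψ : Z ⟶ Y) (φ : Z ⟶ X), ∃ y ∈ closedPoints (var F Y),
    IsComponentOf (V : Set (var F X)) (mor F φ '' (mor F ψ ⁻¹' {y}))

/-- The whole of `F(X)` as a subvariety of itself. -/
def wholeVar (X : C) : Subvar F X where
  carrier := Set.univ
  isIrreducible' := by
    have : IsIntegral (var F X) := (F.obj X).property.1
    exact (irreducibleSpace_def _).mp inferInstance
  isClosed' := isClosed_univ

open Classical in
/-- `⟨V⟩`, the smallest special subvariety containing `V`. (It always exists in a distinguished
category.) -/
def specialHull (V : Subvar F X) : Subvar F X :=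
  if h : ∃ S, IsLeast {S : Subvar F X | IsSpecial S ∧ V ≤ S} S then h.choose else wholeVar X

open Classical in
/-- `⟨V⟩_ws`, the smallest weakly special subvariety containing `V`. (It always exists in a
distinguished category.) -/
def weaklySpecialHull (V : Subvar F X) : Subvar F X :=
  if h : ∃ S, IsLeast {S : Subvar F X | IsWeaklySpecial S ∧ V ≤ S} S then h.choose
  else wholeVar X

/-! ### Defect, optimality and the axiom (A5) -/

/-- The defect `δ(V) = dim ⟨V⟩ - dim V`. -/
def defect (V : Subvar F X) : ℤ :=
  (dim (specialHull V : Set (var F X)) : ℤ) - dim (V : Set (var F X))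

/-- The weak defect `δ_ws(V) = dim ⟨V⟩_ws - dim V`. -/
def weakDefect (V : Subvar F X) : ℤ :=
  (dim (weaklySpecialHull V : Set (var F X)) : ℤ) - dim (V : Set (var F X))

/-- `W` is optimal for `V` in `X`. -/
def IsOptimal (W V : Subvar F X) : Prop :=
  W ≤ V ∧ ∀ U : Subvar F X, W < U → U ≤ V → defect W < defect U

/-- `W` is weakly optimal for `V` in `X`. -/
def IsWeaklyOptimal (W V : Subvar F X) : Prop :=
  W ≤ V ∧ ∀ U : Subvar F X, W < U → U ≤ V → weakDefect W < weakDefect U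

variable (F) in
/-- The axiom (A5) Weak Finiteness. -/
def WeakFiniteness : Prop :=
  ∀ (X : C) (V : Subvar F X), ∃ (n : ℕ) (Y Z : Fin n → C) (φ : ∀ i, Y i ⟶ X)
    (ψ : ∀ i, Y i ⟶ Z i), ∀ W : Subvar F X, IsWeaklyOptimal W V →
      ∃ i, HasFiniteFibers (mor F (φ i)) ∧ ∃ z ∈ closedPoints (var F (Z i)),
        IsComponentOf (weaklySpecialHull W : Set (var F X))
          (mor F (φ i) '' (mor F (ψ i) ⁻¹' {z}))

/-! ### The two formulations of Zilber-Pink -/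

variable (F) in
/-- `ZP(X, m, d)`: every subvariety of `X` of dimension at most `m` contains at most finitely many
optimal subvarieties of defect at most `d`. -/
def ZP (X : C) (m d : ℕ) : Prop :=
  ∀ V : Subvar F X, dim (V : Set (var F X)) ≤ m →
    {W : Subvar F X | IsOptimal W V ∧ defect W ≤ d}.Finite

variable (F) in
/-- Zilber's formulation of the conjecture for given `m` and `d`. -/
def ZilberFormulation (m d : ℕ) : Prop := ∀ X : C, ZP F X m d

variable (F) in
/-- `X^{[k]}`: the union of all special subvarieties of `X` of codimension at least `k`. -/
def specialUnion (X : C) (k : ℤ) : Set (var F X) :=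
  ⋃ S ∈ {S : Subvar F X | IsSpecial S ∧
    k ≤ (dim (Set.univ : Set (var F X)) : ℤ) - dim (S : Set (var F X))}, (S : Set (var F X))

variable (F) in
/-- Pink's formulation of the conjecture for given `m` and `d`: for every subvariety `V` of
dimension at most `m` of a distinguished variety `X`, the set
`V ∩ X^{[dim X - min {δ(V) - 1, d}]}` is not Zariski dense in `V`. -/
def PinkFormulation (m d : ℕ) : Prop :=
  ∀ (X : C) (V : Subvar F X), dim (V : Set (var F X)) ≤ m →
    ¬ (V : Set (var F X)) ⊆ closure ((V : Set (var F X)) ∩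
      specialUnion F X ((dim (Set.univ : Set (var F X)) : ℤ) - min (defect V - 1) (d : ℤ)))

end Categories

end UnlikelyIntersections

end

noncomputable section

namespace UnlikelyIntersections

/-! ### Dimension theory of finitely generated algebras -/

section Algebra

/-! Zilber implies Pink: put k = min {δ(V) - 1, d}. A point x of V lies in X^{[dim X - k]} iff its
closure has special hull of dimension at most k, so this closure has defect at most k. Enlarging it
to an optimal subvariety does not raise the defect (`exists_isOptimal_ge`), so x lies in an optimal
W ≠ V of defect at most d. There are finitely many such W; if the set were dense they would cover V,
and the generic point of V would lie in one of them.

Pink implies Zilber: the number dim ⟨W⟩ - dim ⟨W⟩_ws does not increase when W grows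
(`defect_sub_weakDefect_le`), so optimal subvarieties are weakly optimal. By (A5) and (A4), finitely
many pairs (φ, ψ) therefore present every relevant ⟨W⟩_ws as φ(ψ⁻¹(z)), where φ has finite fibers
and the fibers of ψ are irreducible, of the same dimension e over closed points of the image. Since
W is a component of V ∩ ⟨W⟩_ws, it remains to bound the number of z for which dim W = k is fixed.

If there are infinitely many, they are dense in the closure of a non-closed point v. The W over them
live in φ⁻¹(V), and a fiber dimension argument (`exists_ht_add_le`) gives a point x of φ⁻¹(V) over v
with dim x ≥ dim v + k (dimensions of closures), whose image U = closure of φ(x) contains one of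
these W. As dim ⟨z⟩ + e ≤ dim ⟨W⟩ and k ≤ e, all these z satisfy dim ⟨z⟩ ≤ d, so Pink's statement
for v allows the choice of z with dim ⟨z⟩ ≥ δ(v). Pulling ⟨v⟩ back along ψ gives dim ⟨U⟩ ≤ dim ⟨v⟩ +
e, hence δ(U) ≤ δ(v) + e - k ≤ dim ⟨z⟩ + e - k ≤ δ(W), although W ⊊ U: this contradicts optimality.

Throughout, scheme points stand for subvarieties (a point for its closure), so generic and closed
points are treated alike. The constancy of fiber dimensions in (A4) upgrades the usual inequalities
to equalities such as `dim_image_fiber_add`. -/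

theorem ringKrullDim_eq_of_isIntegral {R S : Type*} [CommRing R] [CommRing S] [Algebra R S]
    [Algebra.IsIntegral R S] (h : Function.Injective (algebraMap R S)) :
    ringKrullDim S = ringKrullDim R := by
  apply le_antisymm
  · exact Order.krullDim_le_of_strictMono (PrimeSpectrum.comap (algebraMap R S))
      fun p q hpq => Ideal.IsIntegral.comap_lt_comap (I := p.asIdeal) (J := q.asIdeal) hpq
  · refine iSup_le fun l => ?_
    obtain ⟨Q, -, hQ, hQ'⟩ := Ideal.exists_ideal_over_prime_of_isIntegral l.head.asIdeal
      (⊥ : Ideal S) (by rw [← RingHom.ker_eq_comap_bot, (RingHom.injective_iff_ker_eq_bot _).mp h]; exact bot_le)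
    have : Q.LiesOver l.head.asIdeal := ⟨hQ'.symm⟩
    obtain ⟨L, hL, -, -⟩ := Ideal.exists_ltSeries_of_hasGoingUp l Q
    rw [← hL]
    exact le_iSup (fun L : LTSeries (PrimeSpectrum S) => ((L.length : ℕ∞) : WithBot ℕ∞)) L

variable (K : Type u) [Field K] (R : Type u) [CommRing R] [IsDomain R] [Algebra K R]

/-- Noether normalization: `R` is integral over a polynomial ring in `s` variables, for which both
invariants equal `s`, and neither changes along the integral extension. -/
theorem exists_ringKrullDim_eq_trdeg [Algebra.FiniteType K R] :
    ∃ n : ℕ, ringKrullDim R = n ∧ Algebra.trdeg K R = n := by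
  obtain ⟨s, g, hg, hi⟩ := exists_integral_inj_algHom_of_fg K R
  let := g.toRingHom.toAlgebra
  have : IsScalarTower K (MvPolynomial (Fin s) K) R :=
    IsScalarTower.of_algebraMap_eq fun x => (g.commutes x).symm
  have : Algebra.IsIntegral (MvPolynomial (Fin s) K) R := ⟨hi⟩
  have : FaithfulSMul (MvPolynomial (Fin s) K) R :=
    (faithfulSMul_iff_algebraMap_injective _ _).mpr hg
  refine ⟨s, ?_, ?_⟩
  · rw [ringKrullDim_eq_of_isIntegral (R := MvPolynomial (Fin s) K) hg]
    simp
  · rw [← trdeg_add_eq K (MvPolynomial (Fin s) K) (A := R),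
      trdeg_eq_zero (R := MvPolynomial (Fin s) K)]
    simp

theorem ringKrullDim_le_natCast_of_isAlgebraic_adjoin [Algebra.FiniteType K R] (s : Set R) (n : ℕ)
    (hs : Cardinal.mk s ≤ n) [Algebra.IsAlgebraic (Algebra.adjoin K s) R] :
    ringKrullDim R ≤ n := by
  obtain ⟨m, hm, hm'⟩ := exists_ringKrullDim_eq_trdeg K R
  have := (Algebra.IsAlgebraic.trdeg_le_cardinalMk K s).trans hs
  rw [hm'] at this
  rw [hm]
  exact_mod_cast this

variable {R} in
theorem ringKrullDim_eq_of_isAlgebraic [Algebra.FiniteType K R] {S : Type u} [CommRing S]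
    [IsDomain S] [Algebra K S] [Algebra.FiniteType K S] [Algebra R S] [IsScalarTower K R S]
    [FaithfulSMul R S] [Algebra.IsAlgebraic R S] : ringKrullDim S = ringKrullDim R := by
  obtain ⟨m, hm, hm'⟩ := exists_ringKrullDim_eq_trdeg K R
  obtain ⟨n, hn, hn'⟩ := exists_ringKrullDim_eq_trdeg K S
  have h := trdeg_add_eq K R (A := S)
  rw [trdeg_eq_zero (R := R), hm', hn', add_zero] at h
  rw [hm, hn]
  exact_mod_cast h.symm

/-- A power of `f`, a unit in the target, moves any element of `S ⧸ P` into the image of `R`. The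
extension of quotient domains is thus algebraic and keeps the transcendence degree. -/
theorem ringKrullDim_quotient_of_isLocalization_away {R S : Type u} [CommRing R] [CommRing S]
    [Algebra K R] [Algebra.FiniteType K R] [Algebra R S] (f : R) [IsLocalization.Away f S]
    (P : Ideal S) [P.IsPrime] :
    ringKrullDim (S ⧸ P) = ringKrullDim (R ⧸ P.comap (algebraMap R S)) := by
  let : Algebra K S := ((algebraMap R S).comp (algebraMap K R)).toAlgebra
  have : IsScalarTower K R S := IsScalarTower.of_algebraMap_eq fun x => rfl
  have : Algebra.FiniteType R S := IsLocalization.finiteType_of_monoid_fg (Submonoid.powers f) S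
  have : Algebra.FiniteType K S := Algebra.FiniteType.trans (S := R) inferInstance inferInstance
  let : Algebra (R ⧸ P.comap (algebraMap R S)) (S ⧸ P) :=
    (Ideal.quotientMap P (algebraMap R S) le_rfl).toAlgebra
  have : FaithfulSMul (R ⧸ P.comap (algebraMap R S)) (S ⧸ P) :=
    (faithfulSMul_iff_algebraMap_injective _ _).mpr Ideal.quotientMap_injective
  have : IsScalarTower K (R ⧸ P.comap (algebraMap R S)) (S ⧸ P) :=
    IsScalarTower.of_algebraMap_eq fun x => rfl
  have : Algebra.IsAlgebraic (R ⧸ P.comap (algebraMap R S)) (S ⧸ P) := by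
    refine ⟨fun x => ?_⟩
    obtain ⟨x, rfl⟩ := Ideal.Quotient.mk_surjective x
    obtain ⟨n, a, ha⟩ := IsLocalization.Away.surj f x
    have hf : Ideal.Quotient.mk P (algebraMap R S f ^ n) ≠ 0 := by
      have h1 := ((IsLocalization.Away.algebraMap_isUnit (S := S) f).pow n).map (Ideal.Quotient.mk P)
      exact h1.ne_zero
    refine IsAlgebraic.of_mul (mem_nonZeroDivisors_of_ne_zero hf) ?_ ?_
    · rw [← map_pow]
      exact isAlgebraic_algebraMap (Ideal.Quotient.mk (P.comap (algebraMap R S)) (f ^ n))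
    · rw [← map_mul, mul_comm, ha]
      exact isAlgebraic_algebraMap (Ideal.Quotient.mk (P.comap (algebraMap R S)) a)
  exact ringKrullDim_eq_of_isAlgebraic K

variable {K R}

/-- Over a dense open subset of the source, the fibers over closed points of a dominant morphism
of affine varieties have at most the expected dimension. -/
theorem exists_ringKrullDim_quotient_add_le (S : Type u) [CommRing S] [IsDomain S] [Algebra K S]
    [Algebra.FiniteType K R] [Algebra.FiniteType K S] [Algebra S R] [IsScalarTower K S R]
    (hinj : Function.Injective (algebraMap S R)) [IsAlgClosed K] :
    ∃ h : R, h ≠ 0 ∧ ∀ p : Ideal R, p.IsPrime → h ∉ p → (p.comap (algebraMap S R)).IsMaximal →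
      ringKrullDim (R ⧸ p) + ringKrullDim S ≤ ringKrullDim R := by
  classical
  have : FaithfulSMul S R := (faithfulSMul_iff_algebraMap_injective _ _).mpr hinj
  obtain ⟨s, hs⟩ := exists_isTranscendenceBasis S R
  obtain ⟨a, ha, ha'⟩ := exists_ringKrullDim_eq_trdeg K R
  obtain ⟨b, hb, hb'⟩ := exists_ringKrullDim_eq_trdeg K S
  have hadd := trdeg_add_eq K S (A := R)
  rw [ha', hb', ← hs.cardinalMk_eq_trdeg] at hadd
  have hfin : Cardinal.mk s < Cardinal.aleph0 :=
    lt_of_le_of_lt (by rw [← hadd]; exact le_add_self) (Cardinal.natCast_lt_aleph0 (n := a))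
  obtain ⟨r, hr⟩ := Cardinal.lt_aleph0.mp hfin
  have hab : b + r = a := by rw [hr] at hadd; exact_mod_cast hadd
  have halg : Algebra.IsAlgebraic (Algebra.adjoin S s) R := by
    have := hs.isAlgebraic
    rwa [Subtype.range_coe] at this
  obtain ⟨t, ht⟩ := ‹Algebra.FiniteType K R›.out
  -- `y` is a common denominator making the generators of `R` integral over `S[s]`. Where `y` does
  -- not vanish, these relations survive modulo `p`.
  obtain ⟨y, hy, hy'⟩ := Algebra.IsAlgebraic.exists_integral_multiples (Algebra.adjoin S s) t
  refine ⟨(y : R), by simpa using hy, fun p hp hyp hmax => ?_⟩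
  rw [ha, hb, ← hab]
  let : Field (S ⧸ p.comap (algebraMap S R)) := Ideal.Quotient.field _
  -- By the Nullstellensatz the residue field is `K`, so `S` contributes only constants to `R ⧸ p`;
  -- hence `R ⧸ p` is algebraic over `K[π(s)]` and has dimension at most the cardinality `r` of `s`.
  have hbij : Function.Surjective (algebraMap K (S ⧸ p.comap (algebraMap S R))) := by
    have : Module.Finite K (S ⧸ p.comap (algebraMap S R)) := finite_of_finite_type_of_isJacobsonRing _ _
    exact (IsAlgClosed.algebraMap_bijective_of_isIntegral (k := K)).2
  set π := Ideal.Quotient.mkₐ K p with hπ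
  set A := Algebra.adjoin K (π '' s) with hA
  have hS : ∀ x : S, π (algebraMap S R x) ∈ A := by
    intro x
    obtain ⟨c, hc⟩ := hbij (Ideal.Quotient.mk _ x)
    have hc' : x - algebraMap K S c ∈ p.comap (algebraMap S R) := by
      rw [← Ideal.Quotient.eq, ← hc]
      rfl
    have : π (algebraMap S R x) = algebraMap K (R ⧸ p) c := by
      rw [Ideal.mem_comap, map_sub, ← IsScalarTower.algebraMap_apply] at hc'
      have h2 := (Ideal.Quotient.eq (I := p)).mpr hc'
      exact h2
    rw [this]
    exact A.algebraMap_mem c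
  have hadj : ∀ x ∈ Algebra.adjoin S s, π x ∈ A := by
    intro x hx
    induction hx using Algebra.adjoin_induction with
    | mem x hx => exact Algebra.subset_adjoin ⟨x, hx, rfl⟩
    | algebraMap r => exact hS r
    | add x y _ _ hx hy => rw [map_add]; exact A.add_mem hx hy
    | mul x y _ _ hx hy => rw [map_mul]; exact A.mul_mem hx hy
  have hy0 : π (y : R) ≠ 0 := fun h => hyp (Ideal.Quotient.eq_zero_iff_mem.mp h)
  let g : Algebra.adjoin S s →+* A :=
    (π.toRingHom.comp (Algebra.adjoin S s).val.toRingHom).codRestrict A.toSubring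
      (fun x => hadj _ x.2)
  have hint : ∀ x ∈ t, _root_.IsIntegral A (π (y : R) * π x) := by
    intro x hx
    have h1 := hy' x hx
    rw [Algebra.smul_def] at h1
    have h2 := _root_.IsIntegral.map_of_comp_eq g π.toRingHom (by ext; rfl) h1
    simpa using h2
  have halg' : Algebra.IsAlgebraic A (R ⧸ p) := by
    have htop : ∀ x : R, IsAlgebraic A (π x) := by
      intro x
      have hx : x ∈ Algebra.adjoin K (t : Set R) := by rw [ht]; trivial
      induction hx using Algebra.adjoin_induction with
      | mem x hx =>
        have h1 := (hint x hx).isAlgebraic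
        exact IsAlgebraic.of_mul (mem_nonZeroDivisors_of_ne_zero hy0)
          (isAlgebraic_algebraMap (⟨π y, hadj _ y.2⟩ : A)) h1
      | algebraMap r =>
        rw [AlgHom.commutes, IsScalarTower.algebraMap_apply K A]
        exact isAlgebraic_algebraMap _
      | add x y _ _ hx hy => rw [map_add]; exact hx.add hy
      | mul x y _ _ hx hy => rw [map_mul]; exact hx.mul hy
    exact ⟨fun x => by obtain ⟨x, rfl⟩ := Ideal.Quotient.mk_surjective x; exact htop x⟩
  have := ringKrullDim_le_natCast_of_isAlgebraic_adjoin K (R ⧸ p) (π '' s) r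
    (Cardinal.mk_image_le.trans hr.le)
  push_cast
  rw [add_comm (b : WithBot ℕ∞)]
  gcongr

theorem ringKrullDim_quotient_eq_coheight {R : Type*} [CommRing R] (p : PrimeSpectrum R) :
    ringKrullDim (R ⧸ p.asIdeal) = Order.coheight p := by
  rw [ringKrullDim_quotient, Order.coheight_eq_krullDim_Ici]
  rfl

/-- Some fiber over a closed point has at least the expected dimension. -/
theorem exists_ringKrullDim_le_add_quotient (S : Type u) [CommRing S] [Algebra K S]
    [Algebra.FiniteType K R] [Algebra.FiniteType K S] [Algebra S R] [IsScalarTower K S R] :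
    ∃ q : Ideal R, q.IsPrime ∧ (q.comap (algebraMap S R)).IsMaximal ∧
      ringKrullDim R ≤ ringKrullDim S + ringKrullDim (R ⧸ q) := by
  obtain ⟨n, hn, -⟩ := exists_ringKrullDim_eq_trdeg K R
  have : FiniteRingKrullDim R := by
    rw [finiteRingKrullDim_iff_ne_bot_and_top, hn]
    exact ⟨WithBot.coe_ne_bot, fun h => ENat.natCast_ne_top n (WithBot.coe_inj.mp h)⟩
  have : IsNoetherianRing R := Algebra.FiniteType.isNoetherianRing K R
  have : IsNoetherianRing S := Algebra.FiniteType.isNoetherianRing K S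
  obtain ⟨P, hP, hPh⟩ := Ideal.exists_isMaximal_height (R := R)
  have hPS : (P.comap (algebraMap S R)).IsMaximal := by
    have : Algebra.FiniteType K (R ⧸ P) := inferInstance
    let : Field (R ⧸ P) := Ideal.Quotient.field _
    have : Module.Finite K (R ⧸ P) := finite_of_finite_type_of_isJacobsonRing _ _
    have hint : Algebra.IsIntegral S (R ⧸ P) := Algebra.IsIntegral.tower_top K
    have h := Ideal.isMaximal_comap_of_isIntegral_of_isMaximal (R := S) (⊥ : Ideal (R ⧸ P))
    have h2 : (⊥ : Ideal (R ⧸ P)).comap (algebraMap S (R ⧸ P)) = P.comap (algebraMap S R) := by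
      ext x
      rw [Ideal.mem_comap, Ideal.mem_bot, IsScalarTower.algebraMap_apply S R (R ⧸ P)]
      exact Ideal.Quotient.eq_zero_iff_mem
    rwa [← h2]
  set p := P.comap (algebraMap S R)
  have : P.LiesOver p := ⟨rfl⟩
  have h := Ideal.height_le_height_add_of_liesOver p P
  set J := p.map (algebraMap S R)
  have hJP : J ≤ P := Ideal.map_comap_le
  have hPbar : (P.map (Ideal.Quotient.mk J)).IsPrime :=
    Ideal.map_isPrime_of_surjective Ideal.Quotient.mk_surjective (by simpa using hJP)
  -- A maximal chain below `P` in the fiber ring `R ⧸ pR`. Its smallest member pulls back to a prime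
  -- containing `p`, which contracts exactly to `p` because `p` is maximal.
  obtain ⟨l, -, hl⟩ := (P.map (Ideal.Quotient.mk J)).exists_ltSeries_length_eq_height
  let q := PrimeSpectrum.comap (Ideal.Quotient.mk J) l.head
  refine ⟨q.asIdeal, q.2, ?_, ?_⟩
  · have : p ≤ q.asIdeal.comap (algebraMap S R) := by
      rw [← Ideal.map_le_iff_le_comap]
      intro x hx
      change Ideal.Quotient.mk J x ∈ l.head.asIdeal
      rw [Ideal.Quotient.eq_zero_iff_mem.mpr hx]
      exact zero_mem _
    rw [← hPS.eq_of_le (Ideal.IsPrime.ne_top inferInstance) this]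
    exact hPS
  · have h1 : (l.length : ℕ∞) ≤ Order.coheight q :=
      (Order.length_le_coheight_head (p := l)).trans (Order.coheight_le_coheight_apply_of_strictMono
        (PrimeSpectrum.comap (Ideal.Quotient.mk J))
        (Monotone.strictMono_of_injective (fun a b hab => Ideal.comap_mono hab)
          (PrimeSpectrum.comap_injective_of_surjective _ Ideal.Quotient.mk_surjective)) _)
    rw [← hPh, ringKrullDim_quotient_eq_coheight]
    refine (WithBot.coe_le_coe.mpr h).trans ?_
    rw [← hl, WithBot.coe_add]
    exact add_le_add (Ideal.height_le_ringKrullDim_of_ne_top hPS.ne_top) (WithBot.coe_le_coe.mpr h1)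

end Algebra

/-! ### Fiber dimension inequalities for primes of affine algebras -/

section PrimeSpectrum

variable (K : Type u) [Field K] {R S : Type u} [CommRing R] [CommRing S] [Algebra K R] [Algebra K S]
  [Algebra.FiniteType K R] [Algebra.FiniteType K S] [Algebra S R] [IsScalarTower K S R]

theorem ringKrullDim_quotient_quotient {R : Type*} [CommRing R] (I : Ideal R) (p : Ideal (R ⧸ I)) :
    ringKrullDim ((R ⧸ I) ⧸ p) = ringKrullDim (R ⧸ p.comap (Ideal.Quotient.mk I)) := by
  have hI : I ≤ p.comap (Ideal.Quotient.mk I) := fun x hx => by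
    rw [Ideal.mem_comap, Ideal.Quotient.eq_zero_iff_mem.mpr hx]
    exact zero_mem _
  have h := ringKrullDim_eq_of_ringEquiv (DoubleQuot.quotQuotEquivQuotOfLE hI)
  rwa [Ideal.map_comap_of_surjective _ Ideal.Quotient.mk_surjective] at h

include K in
theorem exists_coheight_eq_natCast (P : PrimeSpectrum R) : ∃ n : ℕ, Order.coheight P = n := by
  obtain ⟨n, hn, -⟩ := exists_ringKrullDim_eq_trdeg K (R ⧸ P.asIdeal)
  rw [ringKrullDim_quotient_eq_coheight] at hn
  exact ⟨n, WithBot.coe_inj.mp hn⟩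

include K in
theorem exists_coheight_add_le [IsAlgClosed K] (P : PrimeSpectrum R) :
    ∃ h : R, h ∉ P.asIdeal ∧ ∀ p : PrimeSpectrum R, P ≤ p → h ∉ p.asIdeal →
      (PrimeSpectrum.comap (algebraMap S R) p).asIdeal.IsMaximal →
      Order.coheight p + Order.coheight (PrimeSpectrum.comap (algebraMap S R) P) ≤
        Order.coheight P := by
  let Q := PrimeSpectrum.comap (algebraMap S R) P
  let : Algebra (S ⧸ Q.asIdeal) (R ⧸ P.asIdeal) :=
    (Ideal.quotientMap P.asIdeal (algebraMap S R) le_rfl).toAlgebra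
  have : IsScalarTower K (S ⧸ Q.asIdeal) (R ⧸ P.asIdeal) :=
    IsScalarTower.of_algebraMap_eq fun x => by
      rw [IsScalarTower.algebraMap_apply K R (R ⧸ P.asIdeal), IsScalarTower.algebraMap_apply K S R]
      rfl
  obtain ⟨h, hh, H⟩ := exists_ringKrullDim_quotient_add_le (K := K) (R := R ⧸ P.asIdeal)
    (S ⧸ Q.asIdeal) Ideal.quotientMap_injective
  obtain ⟨h, rfl⟩ := Ideal.Quotient.mk_surjective h
  refine ⟨h, fun hP => hh (Ideal.Quotient.eq_zero_iff_mem.mpr hP), fun p hPp hhp hmax => ?_⟩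
  have hcomap : (p.asIdeal.map (Ideal.Quotient.mk P.asIdeal)).comap (Ideal.Quotient.mk P.asIdeal) =
      p.asIdeal := Ideal.comap_map_mk hPp
  have hprime : (p.asIdeal.map (Ideal.Quotient.mk P.asIdeal)).IsPrime :=
    Ideal.map_isPrime_of_surjective Ideal.Quotient.mk_surjective (by simpa using hPp)
  have h1 := H (p.asIdeal.map (Ideal.Quotient.mk P.asIdeal)) hprime
    (fun hmem => hhp (by rw [← hcomap]; exact hmem)) (by
      set J := (p.asIdeal.map (Ideal.Quotient.mk P.asIdeal)).comap
        (algebraMap (S ⧸ Q.asIdeal) (R ⧸ P.asIdeal))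
      have hJ : J.comap (Ideal.Quotient.mk Q.asIdeal) = p.asIdeal.comap (algebraMap S R) := by
        conv_rhs => rw [← hcomap]
        rfl
      have hJ' := Ideal.map_comap_of_surjective (Ideal.Quotient.mk Q.asIdeal)
        Ideal.Quotient.mk_surjective J
      have hmax' : (p.asIdeal.comap (algebraMap S R)).IsMaximal := hmax
      rw [← hJ] at hmax'
      rcases Ideal.map_eq_top_or_isMaximal_of_surjective (Ideal.Quotient.mk Q.asIdeal)
        Ideal.Quotient.mk_surjective hmax' with h2 | h2
      · rw [hJ'] at h2
        exact absurd h2 (Ideal.IsPrime.ne_top inferInstance)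
      · rwa [hJ'] at h2)
  rw [ringKrullDim_quotient_quotient, hcomap, ringKrullDim_quotient_eq_coheight,
    ringKrullDim_quotient_eq_coheight, ringKrullDim_quotient_eq_coheight] at h1
  exact WithBot.coe_le_coe.mp h1

include K in
theorem exists_coheight_le_add (P : PrimeSpectrum R) :
    ∃ q : PrimeSpectrum R, P ≤ q ∧ (PrimeSpectrum.comap (algebraMap S R) q).asIdeal.IsMaximal ∧
      Order.coheight P ≤ Order.coheight (PrimeSpectrum.comap (algebraMap S R) P) +
        Order.coheight q := by
  let Q := PrimeSpectrum.comap (algebraMap S R) P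
  let : Algebra (S ⧸ Q.asIdeal) (R ⧸ P.asIdeal) :=
    (Ideal.quotientMap P.asIdeal (algebraMap S R) le_rfl).toAlgebra
  have : IsScalarTower K (S ⧸ Q.asIdeal) (R ⧸ P.asIdeal) :=
    IsScalarTower.of_algebraMap_eq fun x => by
      rw [IsScalarTower.algebraMap_apply K R (R ⧸ P.asIdeal), IsScalarTower.algebraMap_apply K S R]
      rfl
  obtain ⟨q, hq, hmax, hle⟩ := exists_ringKrullDim_le_add_quotient (K := K) (R := R ⧸ P.asIdeal)
    (S ⧸ Q.asIdeal)
  refine ⟨PrimeSpectrum.comap (Ideal.Quotient.mk P.asIdeal) ⟨q, hq⟩, ?_, ?_, ?_⟩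
  · intro x hx
    change Ideal.Quotient.mk P.asIdeal x ∈ q
    rw [Ideal.Quotient.eq_zero_iff_mem.mpr hx]
    exact zero_mem _
  · exact Ideal.comap_isMaximal_of_surjective (Ideal.Quotient.mk Q.asIdeal)
      Ideal.Quotient.mk_surjective (K := q.comap (algebraMap (S ⧸ Q.asIdeal) (R ⧸ P.asIdeal)))
  · rw [ringKrullDim_quotient_quotient, ringKrullDim_quotient_eq_coheight,
      ringKrullDim_quotient_eq_coheight] at hle
    have h2 := ringKrullDim_quotient_eq_coheight
      (PrimeSpectrum.comap (Ideal.Quotient.mk P.asIdeal) ⟨q, hq⟩)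
    rw [PrimeSpectrum.comap_asIdeal] at h2
    rw [h2] at hle
    exact WithBot.coe_le_coe.mp hle

end PrimeSpectrum

/-! ### From affine charts to points of schemes of finite type -/

section Affine

variable {K : Type u} [Field K] {X Y : Scheme.{u}}

/-- The ring of sections of a `K`-scheme as a `K`-algebra. -/
abbrev sectionsAlgebra (s : X ⟶ Spec (CommRingCat.of K)) (U : X.Opens) : Algebra K Γ(X, U) :=
  ((Scheme.ΓSpecIso (CommRingCat.of K)).inv ≫ s.appLE ⊤ U le_top).hom.toAlgebra

theorem finiteType_sections (s : X ⟶ Spec (CommRingCat.of K)) [LocallyOfFiniteType s] {U : X.Opens}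
    (hU : IsAffineOpen U) :
    letI := sectionsAlgebra s U
    Algebra.FiniteType K Γ(X, U) := by
  let := sectionsAlgebra s U
  have h := s.finiteType_appLE (isAffineOpen_top _) hU le_top
  rw [← RingHom.finiteType_algebraMap]
  have h2 : (Scheme.ΓSpecIso (CommRingCat.of K)).inv.hom.FiniteType :=
    RingHom.FiniteType.of_surjective _
      (Scheme.ΓSpecIso (CommRingCat.of K)).symm.commRingCatIsoToRingEquiv.surjective
  exact h.comp h2

theorem fromSpec_specializes_iff {U : X.Opens} (hU : IsAffineOpen U)
    (p q : PrimeSpectrum Γ(X, U)) : hU.fromSpec p ⤳ hU.fromSpec q ↔ p ≤ q := by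
  rw [PrimeSpectrum.le_iff_specializes]
  exact hU.fromSpec.isOpenEmbedding.isInducing.specializes_iff

theorem primeIdealOf_le_iff {U : X.Opens} (hU : IsAffineOpen U) (x y : U) :
    hU.primeIdealOf x ≤ hU.primeIdealOf y ↔ (x : X) ⤳ y := by
  have h := fromSpec_specializes_iff hU (hU.primeIdealOf x) (hU.primeIdealOf y)
  rw [← h, ← hU.fromSpec_primeIdealOf x, ← hU.fromSpec_primeIdealOf y]

theorem strictMono_fromSpec {U : X.Opens} (hU : IsAffineOpen U) :
    StrictMono (fun p : (PrimeSpectrum Γ(X, U))ᵒᵈ =>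
      (hU.fromSpec (OrderDual.ofDual p : PrimeSpectrum Γ(X, U)) : X)) := by
  intro p q hpq
  have h1 := lt_iff_le_not_ge.mp (OrderDual.ofDual_lt_ofDual.mpr hpq)
  rw [← fromSpec_specializes_iff hU, ← fromSpec_specializes_iff hU] at h1
  exact lt_iff_le_not_ge.mpr h1

theorem mem_basicOpen_iff_notMem_primeIdealOf {U : X.Opens} (hU : IsAffineOpen U) (h : Γ(X, U))
    (x : X) (hx : x ∈ U) : x ∈ X.basicOpen h ↔ h ∉ (hU.primeIdealOf ⟨x, hx⟩).asIdeal := by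
  have h1 : hU.fromSpec (hU.primeIdealOf ⟨x, hx⟩) = x := hU.fromSpec_primeIdealOf _
  have h2 : hU.primeIdealOf ⟨x, hx⟩ ∈ hU.fromSpec ⁻¹ᵁ X.basicOpen h ↔ x ∈ X.basicOpen h := by
    conv_rhs => rw [← h1]
    rfl
  rw [← h2, hU.fromSpec_preimage_basicOpen]
  rfl

theorem primeIdealOf_fromSpec {U : X.Opens} (hU : IsAffineOpen U) (p : PrimeSpectrum Γ(X, U))
    (hp : hU.fromSpec p ∈ U) : hU.primeIdealOf ⟨hU.fromSpec p, hp⟩ = p :=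
  hU.fromSpec.isOpenEmbedding.injective (hU.fromSpec_primeIdealOf _)

theorem fromSpec_mem {U : X.Opens} (hU : IsAffineOpen U) (p : PrimeSpectrum Γ(X, U)) :
    hU.fromSpec p ∈ U := by
  have : hU.fromSpec p ∈ Set.range hU.fromSpec := ⟨p, rfl⟩
  rwa [hU.range_fromSpec] at this

theorem coheight_primeIdealOf_basicOpen (s : X ⟶ Spec (CommRingCat.of K)) [LocallyOfFiniteType s]
    {U : X.Opens} (hU : IsAffineOpen U) (f : Γ(X, U)) (x : X) (hx : x ∈ X.basicOpen f) :
    Order.coheight ((hU.basicOpen f).primeIdealOf ⟨x, hx⟩) =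
      Order.coheight (hU.primeIdealOf ⟨x, X.basicOpen_le f hx⟩) := by
  let := sectionsAlgebra s U
  have := finiteType_sections s hU
  have := hU.isLocalization_basicOpen f
  have h := ringKrullDim_quotient_of_isLocalization_away K f
    ((hU.basicOpen f).primeIdealOf ⟨x, hx⟩).asIdeal
  have h2 : PrimeSpectrum.comap (algebraMap Γ(X, U) Γ(X, X.basicOpen f))
      ((hU.basicOpen f).primeIdealOf ⟨x, hx⟩) = hU.primeIdealOf ⟨x, X.basicOpen_le f hx⟩ := by
    apply hU.fromSpec.isOpenEmbedding.injective
    have h3 := hU.map_fromSpec (hU.basicOpen f) (homOfLE (X.basicOpen_le f)).op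
    have h4 := congr($h3 ((hU.basicOpen f).primeIdealOf ⟨x, hx⟩))
    have h5 : (hU.basicOpen f).fromSpec ((hU.basicOpen f).primeIdealOf ⟨x, hx⟩) = x :=
      (hU.basicOpen f).fromSpec_primeIdealOf _
    exact (h4.trans h5).trans (hU.fromSpec_primeIdealOf ⟨x, X.basicOpen_le f hx⟩).symm
  rw [← PrimeSpectrum.comap_asIdeal, h2, ringKrullDim_quotient_eq_coheight,
    ringKrullDim_quotient_eq_coheight] at h
  exact WithBot.coe_inj.mp h

theorem coheight_primeIdealOf_eq (s : X ⟶ Spec (CommRingCat.of K)) [LocallyOfFiniteType s]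
    {U V : X.Opens} (hU : IsAffineOpen U) (hV : IsAffineOpen V) (x : X) (hxU : x ∈ U)
    (hxV : x ∈ V) :
    Order.coheight (hU.primeIdealOf ⟨x, hxU⟩) = Order.coheight (hV.primeIdealOf ⟨x, hxV⟩) := by
  obtain ⟨f, g, hfg, hx⟩ := exists_basicOpen_le_affine_inter hU hV x ⟨hxU, hxV⟩
  rw [← coheight_primeIdealOf_basicOpen s hU f x hx,
    ← coheight_primeIdealOf_basicOpen s hV g x (hfg ▸ hx)]
  have key : ∀ (W W' : X.Opens) (hW : IsAffineOpen W) (hW' : IsAffineOpen W') (hx : x ∈ W)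
      (hx' : x ∈ W'), W = W' → Order.coheight (hW.primeIdealOf ⟨x, hx⟩) =
        Order.coheight (hW'.primeIdealOf ⟨x, hx'⟩) := by
    rintro W W' hW hW' hx hx' rfl
    rfl
  exact key _ _ _ _ _ _ hfg

/-- A chain of specializations of `x` lies entirely in any affine open containing its most special
member. As the coheight does not depend on the chart, every chart around `x` computes the dimension
of its closure, even if it misses part of that closure. -/
theorem coheight_primeIdealOf (s : X ⟶ Spec (CommRingCat.of K)) [LocallyOfFiniteType s]
    {U : X.Opens} (hU : IsAffineOpen U) (x : X) (hx : x ∈ U) :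
    Order.coheight (hU.primeIdealOf ⟨x, hx⟩) = Order.height x := by
  apply le_antisymm
  · have := Order.height_le_height_apply_of_strictMono _ (strictMono_fromSpec hU)
      (OrderDual.toDual (hU.primeIdealOf ⟨x, hx⟩))
    have h2 : hU.fromSpec (hU.primeIdealOf ⟨x, hx⟩) = x := hU.fromSpec_primeIdealOf _
    exact this.trans (le_of_eq (congrArg _ h2))
  · refine Order.height_le fun l hl => ?_
    obtain ⟨V, hV, hlV, -⟩ := exists_isAffineOpen_mem_and_subset (x := l.head) (U := ⊤) trivial
    have hmem : ∀ i, l i ∈ V := fun i => by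
      have : l i ⤳ l.head := LTSeries.head_le _ i
      exact this.mem_open V.2 hlV
    have hxV : x ∈ V := by rw [← hl]; exact hmem _
    rw [coheight_primeIdealOf_eq s hU hV x hx hxV]
    let L : LTSeries (PrimeSpectrum Γ(X, V))ᵒᵈ := LTSeries.mk l.length
      (fun i => OrderDual.toDual (hV.primeIdealOf ⟨l i, hmem i⟩)) (fun i j hij => by
        have := l.strictMono hij
        rw [lt_iff_le_not_ge] at this ⊢
        rw [OrderDual.toDual_le_toDual, OrderDual.toDual_le_toDual, primeIdealOf_le_iff,
          primeIdealOf_le_iff]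
        exact this)
    have h1 := Order.length_le_height_last (p := L)
    have h2 : L.last = OrderDual.toDual (hV.primeIdealOf ⟨x, hxV⟩) := by
      subst hl
      rfl
    rw [h2] at h1
    exact h1

theorem exists_height_eq_natCast (s : X ⟶ Spec (CommRingCat.of K)) [LocallyOfFiniteType s] (x : X) :
    ∃ n : ℕ, Order.height x = n := by
  obtain ⟨U, hU, hxU, -⟩ := exists_isAffineOpen_mem_and_subset (x := x) (U := ⊤) trivial
  rw [← coheight_primeIdealOf s hU x hxU]
  let := sectionsAlgebra s U
  have := finiteType_sections s hU
  exact exists_coheight_eq_natCast K _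

theorem exists_chain_of_mem_open (s : X ⟶ Spec (CommRingCat.of K)) [LocallyOfFiniteType s] (x : X)
    (n : ℕ) (hn : Order.height x = n) (U : Set X) (hU : IsOpen U) (hx : x ∈ U) :
    ∃ l : LTSeries X, l.length = n ∧ l.last = x ∧ ∀ i, l i ∈ U := by
  obtain ⟨V, hV, hxV, hVU⟩ := exists_isAffineOpen_mem_and_subset (x := x) (U := ⟨U, hU⟩) hx
  rw [← coheight_primeIdealOf s hV x hxV] at hn
  obtain ⟨l, hl, hl'⟩ := Order.exists_series_of_le_height
    (OrderDual.toDual (hV.primeIdealOf ⟨x, hxV⟩)) hn.ge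
  refine ⟨l.map _ (strictMono_fromSpec hV), hl', ?_, ?_⟩
  · rw [LTSeries.last_map, hl]
    exact hV.fromSpec_primeIdealOf _
  · intro i
    exact hVU (fromSpec_mem hV _)

theorem isScalarTower_sections (f : X ⟶ Y) (s : Y ⟶ Spec (CommRingCat.of K)) (V : Y.Opens) (U : X.Opens) (e : U ≤ f ⁻¹ᵁ V) :
    letI := sectionsAlgebra s V
    letI := sectionsAlgebra (f ≫ s) U
    letI := (f.appLE V U e).hom.toAlgebra
    IsScalarTower K Γ(Y, V) Γ(X, U) := by
  let := sectionsAlgebra s V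
  let := sectionsAlgebra (f ≫ s) U
  let := (f.appLE V U e).hom.toAlgebra
  refine IsScalarTower.of_algebraMap_eq' ?_
  have h := Scheme.Hom.appLE_comp_appLE f s ⊤ V U le_top e
  change ((Scheme.ΓSpecIso (CommRingCat.of K)).inv ≫ (f ≫ s).appLE ⊤ U le_top).hom =
    ((Scheme.ΓSpecIso (CommRingCat.of K)).inv ≫ s.appLE ⊤ V le_top ≫ f.appLE V U e).hom
  rw [h]

variable [IsAlgClosed K] (f : X ⟶ Y) (s : Y ⟶ Spec (CommRingCat.of K)) [LocallyOfFiniteType s]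
  [LocallyOfFiniteType f]

include s in
/-- Generic upper bound for the dimension of the fibers. -/
theorem exists_open_height_add_height_le (x : X) :
    ∃ U : Set X, IsOpen U ∧ x ∈ U ∧ ∀ w ∈ U, x ⤳ w → IsClosed {f w} →
      Order.height w + Order.height (f x) ≤ Order.height x := by
  obtain ⟨V, hV, hxV, -⟩ := exists_isAffineOpen_mem_and_subset (x := f x) (U := ⊤) trivial
  obtain ⟨U, hU, hx, e⟩ := exists_isAffineOpen_mem_and_subset (x := x) (U := f ⁻¹ᵁ V) hxV
  replace e : U ≤ f ⁻¹ᵁ V := e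
  let := sectionsAlgebra s V
  let := sectionsAlgebra (f ≫ s) U
  let := (f.appLE V U e).hom.toAlgebra
  have := finiteType_sections s hV
  have := finiteType_sections (f ≫ s) hU
  have := isScalarTower_sections f s V U e
  have hfV : ∀ w ∈ U, f w ∈ V := fun w hw => e hw
  have hcomap : ∀ w (hw : w ∈ U), PrimeSpectrum.comap (algebraMap Γ(Y, V) Γ(X, U))
      (hU.primeIdealOf ⟨w, hw⟩) = hV.primeIdealOf ⟨f w, hfV w hw⟩ := fun w hw =>
    IsAffineOpen.comap_primeIdealOf_appLE V hV U hU e hw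
  obtain ⟨h, hh, H⟩ := exists_coheight_add_le K (S := Γ(Y, V)) (hU.primeIdealOf ⟨x, hx⟩)
  have hmem := mem_basicOpen_iff_notMem_primeIdealOf hU h
  refine ⟨X.basicOpen h, (X.basicOpen h).2, (hmem x hx).mpr hh, fun w hw hxw hcl => ?_⟩
  have hwU := X.basicOpen_le h hw
  have := H (hU.primeIdealOf ⟨w, hwU⟩) ((primeIdealOf_le_iff hU ⟨x, hx⟩ ⟨w, hwU⟩).mpr hxw)
    ((hmem w hwU).mp hw) (by
      rw [hcomap]
      exact hV.primeIdealOf_isMaximal_of_isClosed _ hcl)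
  rwa [hcomap, coheight_primeIdealOf (f ≫ s), coheight_primeIdealOf s,
    coheight_primeIdealOf (f ≫ s)] at this

omit [IsAlgClosed K] in
include s in
/-- Some fiber over a closed point has at least the expected dimension. -/
theorem exists_height_le_add_height (x : X) :
    ∃ w : X, x ⤳ w ∧ IsClosed {f w} ∧ Order.height x ≤ Order.height (f x) + Order.height w := by
  obtain ⟨V, hV, hxV, -⟩ := exists_isAffineOpen_mem_and_subset (x := f x) (U := ⊤) trivial
  obtain ⟨U, hU, hx, e⟩ := exists_isAffineOpen_mem_and_subset (x := x) (U := f ⁻¹ᵁ V) hxV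
  replace e : U ≤ f ⁻¹ᵁ V := e
  let := sectionsAlgebra s V
  let := sectionsAlgebra (f ≫ s) U
  let := (f.appLE V U e).hom.toAlgebra
  have := finiteType_sections s hV
  have := finiteType_sections (f ≫ s) hU
  have := isScalarTower_sections f s V U e
  have hfV : ∀ w ∈ U, f w ∈ V := fun w hw => e hw
  have hcomap : ∀ w (hw : w ∈ U), PrimeSpectrum.comap (algebraMap Γ(Y, V) Γ(X, U))
      (hU.primeIdealOf ⟨w, hw⟩) = hV.primeIdealOf ⟨f w, hfV w hw⟩ := fun w hw =>
    IsAffineOpen.comap_primeIdealOf_appLE V hV U hU e hw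
  obtain ⟨q, hle, hmax, H⟩ := exists_coheight_le_add K (S := Γ(Y, V)) (hU.primeIdealOf ⟨x, hx⟩)
  obtain ⟨w, hw, rfl⟩ : ∃ w, ∃ hw : w ∈ U, hU.primeIdealOf ⟨w, hw⟩ = q :=
    ⟨_, fromSpec_mem hU q, primeIdealOf_fromSpec hU q _⟩
  refine ⟨w, (primeIdealOf_le_iff hU _ _).mp hle, ?_, ?_⟩
  · rw [hcomap] at hmax
    -- In a Jacobson space a point closed in an open chart is closed globally.
    have := LocallyOfFiniteType.jacobsonSpace s
    have h3 := (PrimeSpectrum.isClosed_singleton_iff_isMaximal _).mpr hmax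
    have h4 := hV.fromSpec.isOpenEmbedding.preimage_closedPoints
    have h5 : hV.fromSpec (hV.primeIdealOf ⟨f w, hfV w hw⟩) ∈ closedPoints Y := h4.ge h3
    rwa [hV.fromSpec_primeIdealOf] at h5
  · rwa [hcomap, coheight_primeIdealOf (f ≫ s), coheight_primeIdealOf s,
      coheight_primeIdealOf (f ≫ s)] at H

end Affine

/-! ### Topological Krull dimension and chains of points -/

section KrullDim

theorem le_topologicalKrullDim_of_chain {T : Type*} [TopologicalSpace T] (n : ℕ)
    (y : Fin (n + 1) → T) (h : ∀ i j, i < j → y j ⤳ y i ∧ ¬ y i ⤳ y j) :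
    (n : WithBot ℕ∞) ≤ topologicalKrullDim T := by
  let L : LTSeries (IrreducibleCloseds T) := LTSeries.mk n
    (fun i => ⟨closure {y i}, isIrreducible_singleton.closure, isClosed_closure⟩)
    (fun i j hij => by
      obtain ⟨h1, h2⟩ := h i j hij
      rw [specializes_iff_closure_subset] at h1 h2
      exact lt_iff_le_not_ge.mpr ⟨h1, h2⟩)
  exact le_iSup (fun L : LTSeries (IrreducibleCloseds T) => ((L.length : ℕ∞) : WithBot ℕ∞)) L

theorem topologicalKrullDim_le_of_height_le {X : Scheme.{u}} (S : Set X) (hS : IsClosed S) (n : ℕ)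
    (h : ∀ x ∈ S, Order.height x ≤ n) : topologicalKrullDim S ≤ n := by
  refine iSup_le fun l => ?_
  let g : IrreducibleCloseds S → IrreducibleCloseds X :=
    IrreducibleCloseds.map Subtype.val continuous_subtype_val
  have hg : StrictMono g := IrreducibleCloseds.map_strictMono_of_isInducing .subtypeVal
  let γ : IrreducibleCloseds X → X := fun Z => Z.isIrreducible.genericPoint
  have hγ : ∀ Z : IrreducibleCloseds X, closure {γ Z} = (Z : Set X) := fun Z => by
    have := Z.isIrreducible.genericPoint_closure_eq
    rwa [Z.isClosed.closure_eq] at this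
  have hγ' : StrictMono γ := fun Z Z' hZ => by
    rw [lt_iff_le_not_ge, Scheme.le_iff_specializes, Scheme.le_iff_specializes,
      specializes_iff_closure_subset, specializes_iff_closure_subset, hγ, hγ]
    exact lt_iff_le_not_ge.mp hZ
  have h1 := Order.length_le_height_last (p := l.map _ (hγ'.comp hg))
  have h2 : (l.map _ (hγ'.comp hg)).last ∈ S := by
    rw [LTSeries.last_map]
    have h3 : γ (g l.last) ∈ closure {γ (g l.last)} := subset_closure rfl
    rw [hγ] at h3
    exact hS.closure_subset_iff.mpr (by rintro _ ⟨x, -, rfl⟩; exact x.2) h3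
  exact_mod_cast h1.trans (h _ h2)

end KrullDim

variable {K : Type u} [Field K] {C : Type v} [Category.{w} C] (F : C ⥤ VarietyCat K)

section Instances

variable (A : C)

instance : IsIntegral (var F A) := (F.obj A).property.1

instance : LocallyOfFiniteType (str F A) := (F.obj A).property.2.2.1

instance : QuasiCompact (str F A) := (F.obj A).property.2.2.2

instance : JacobsonSpace (var F A) := LocallyOfFiniteType.jacobsonSpace (str F A)

instance : IsLocallyNoetherian (var F A) := LocallyOfFiniteType.isLocallyNoetherian (str F A)

instance : CompactSpace (var F A) := QuasiCompact.compactSpace_of_compactSpace (str F A)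

instance : IsNoetherian (var F A) where

instance {A B : C} (φ : A ⟶ B) : LocallyOfFiniteType (mor F φ) :=
  have : LocallyOfFiniteType (mor F φ ≫ str F B) := by rw [mor_str]; infer_instance
  locallyOfFiniteType_of_comp (mor F φ) (str F B)

end Instances

/-- The dimension of the closure of a point of a variety. -/
def ht {X : Scheme.{u}} (x : X) : ℕ := (Order.height x).toNat

/-! ### Dimension of closed subsets through heights of points -/

section Height

variable {F} {A B : C}

theorem height_eq_ht (x : var F A) : Order.height x = ht x := by
  obtain ⟨n, hn⟩ := exists_height_eq_natCast (str F A) x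
  rw [ht, hn, ENat.toNat_natCast]

theorem ht_le_of_specializes {x y : var F A} (h : x ⤳ y) : ht y ≤ ht x := by
  have := Order.height_mono (show y ≤ x from h)
  rw [height_eq_ht, height_eq_ht] at this
  exact_mod_cast this

theorem ht_lt_of_specializes {x y : var F A} (h : x ⤳ y) (hne : x ≠ y) : ht y < ht x := by
  have hlt : y < x := lt_iff_le_not_ge.mpr ⟨h, fun h' => hne (h.antisymm h').eq⟩
  have := Order.height_strictMono hlt (by rw [height_eq_ht]; exact ENat.natCast_lt_top _)
  rw [height_eq_ht, height_eq_ht] at this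
  exact_mod_cast this

theorem ht_eq_zero_iff {x : var F A} : ht x = 0 ↔ IsClosed {x} := by
  constructor
  · intro h
    rw [← closure_subset_iff_isClosed]
    intro y hy
    by_contra hne
    have := ht_lt_of_specializes (specializes_iff_mem_closure.mpr hy) (Ne.symm hne)
    omega
  · intro h
    rw [ht, Scheme.height_of_isClosed h]
    rfl

/-- Heights are bounded by that of the generic point of the variety, so a maximum over `S` is
attained. Generic points turn chains of irreducible closed subsets into chains of specializations,
and back. -/
theorem topologicalKrullDim_eq {S : Set (var F A)} (hS : IsClosed S) (hne : S.Nonempty) :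
    ∃ x ∈ S, (∀ y ∈ S, ht y ≤ ht x) ∧ topologicalKrullDim S = ht x := by
  have hbdd : BddAbove (ht '' S) := by
    refine ⟨ht (genericPoint (var F A)), ?_⟩
    rintro _ ⟨y, -, rfl⟩
    exact ht_le_of_specializes (genericPoint_specializes y)
  obtain ⟨x, hx, hmax⟩ := Nat.sSup_mem (hne.image ht) hbdd
  have hmax' : ∀ y ∈ S, ht y ≤ ht x := fun y hy => by
    rw [hmax]
    exact le_csSup hbdd ⟨y, hy, rfl⟩
  refine ⟨x, hx, hmax', le_antisymm ?_ ?_⟩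
  · refine topologicalKrullDim_le_of_height_le S hS _ fun y hy => ?_
    rw [height_eq_ht]
    exact_mod_cast hmax' y hy
  · obtain ⟨l, hl, hl', -⟩ := exists_chain_of_mem_open (str F A) x (ht x) (height_eq_ht x)
      Set.univ isOpen_univ trivial
    rw [← hl]
    refine le_topologicalKrullDim_of_chain l.length (fun i => (⟨l i, ?_⟩ : S)) ?_
    · have h1 : x ⤳ l i := by
        rw [← hl']
        exact l.monotone (Fin.le_last i)
      exact h1.mem_closed hS hx
    · intro i j hij
      have h1 := lt_iff_le_not_ge.mp (l.strictMono hij)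
      rw [← Topology.IsInducing.subtypeVal.specializes_iff,
        ← Topology.IsInducing.subtypeVal.specializes_iff]
      exact h1

theorem topologicalKrullDim_eq_dim {S : Set (var F A)} (hS : IsClosed S) (hne : S.Nonempty) :
    topologicalKrullDim S = dim S := by
  obtain ⟨x, -, -, h⟩ := topologicalKrullDim_eq hS hne
  rw [dim, h]
  rfl

theorem exists_ht_eq_dim {S : Set (var F A)} (hS : IsClosed S) (hne : S.Nonempty) :
    ∃ x ∈ S, ht x = dim S := by
  obtain ⟨x, hx, -, h⟩ := topologicalKrullDim_eq hS hne
  refine ⟨x, hx, ?_⟩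
  rw [dim, h]
  rfl

theorem ht_le_dim {S : Set (var F A)} (hS : IsClosed S) {x : var F A} (hx : x ∈ S) :
    ht x ≤ dim S := by
  obtain ⟨y, -, hy', h⟩ := topologicalKrullDim_eq hS ⟨x, hx⟩
  have : dim S = ht y := by
    rw [dim, h]
    rfl
  rw [this]
  exact hy' x hx

theorem dim_le {S : Set (var F A)} (hS : IsClosed S) (hne : S.Nonempty) {n : ℕ}
    (h : ∀ x ∈ S, ht x ≤ n) : dim S ≤ n := by
  obtain ⟨x, hx, hx'⟩ := exists_ht_eq_dim hS hne
  rw [← hx']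
  exact h x hx

theorem dim_mono {S T : Set (var F A)} (hS : IsClosed S) (hT : IsClosed T) (hne : S.Nonempty)
    (h : S ⊆ T) : dim S ≤ dim T :=
  dim_le hS hne fun _ hx => ht_le_dim hT (h hx)

theorem dim_closure_singleton (x : var F A) : dim (closure {x}) = ht x := by
  refine le_antisymm (dim_le isClosed_closure ⟨x, subset_closure (Set.mem_singleton x)⟩ fun y hy => ?_)
    (ht_le_dim isClosed_closure (subset_closure (Set.mem_singleton x)))
  exact ht_le_of_specializes (specializes_iff_mem_closure.mpr hy)

/-- A chain of maximal length ending in the generic point of `S` can be chosen inside any open set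
containing that point, hence inside any open set meeting `S`. -/
theorem localDim_eq_dim {S : Set (var F A)} (hS : IsClosed S) (hirr : IsIrreducible S) (w : S) :
    localDim w = dim S := by
  apply le_antisymm
  · rw [← topologicalKrullDim_eq_dim hS hirr.1]
    exact (iInf_le _ ⊤).trans (topologicalKrullDim_subspace_le _ _)
  · refine le_iInf fun U => ?_
    obtain ⟨V, hV, hVU⟩ := isOpen_induced_iff.mp U.1.2
    have hgen := hirr.genericPoint_closure_eq
    rw [hS.closure_eq] at hgen
    set ξ := hirr.genericPoint
    have hξS : ξ ∈ S := by
      rw [← hgen]; exact subset_closure rfl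
    have hξw : ξ ⤳ w := by
      rw [specializes_iff_mem_closure, hgen]; exact w.2
    have hwV : (w : var F A) ∈ V := by
      have : w ∈ (Subtype.val ⁻¹' V : Set S) := by rw [hVU]; exact U.2
      exact this
    have hξV : ξ ∈ V := hξw.mem_open hV hwV
    obtain ⟨l, hl, hl', hlV⟩ := exists_chain_of_mem_open (str F A) ξ (ht ξ) (height_eq_ht ξ)
      V hV hξV
    have hlS : ∀ i, l i ∈ S := fun i => by
      have h1 : ξ ⤳ l i := by
        rw [← hl']
        exact l.monotone (Fin.le_last i)
      exact h1.mem_closed hS hξS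
    have hdim : dim S = l.length := by rw [hl, ← dim_closure_singleton, hgen]
    rw [hdim]
    refine le_topologicalKrullDim_of_chain l.length (fun i => (⟨⟨l i, hlS i⟩, ?_⟩ : U.1.1)) ?_
    · rw [← hVU]
      exact hlV i
    · intro i j hij
      have h1 := lt_iff_le_not_ge.mp (l.strictMono hij)
      rw [← Topology.IsInducing.subtypeVal.specializes_iff,
        ← Topology.IsInducing.subtypeVal.specializes_iff,
        ← Topology.IsInducing.subtypeVal.specializes_iff,
        ← Topology.IsInducing.subtypeVal.specializes_iff]
      exact h1

end Height

/-! ### Fiber dimension for distinguished morphisms -/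

section Fibers

variable {K : Type u} [Field K] {C : Type v} [Category.{w} C] {F : C ⥤ VarietyCat K}
  {A B : C} (φ : A ⟶ B)

theorem isClosed_map {x : var F A} (hx : IsClosed {x}) : IsClosed {mor F φ x} :=
  Scheme.Hom.closePoints_subset_preimage_closedPoints (mor F φ) hx

theorem continuous_mor : Continuous (mor F φ) := (mor F φ).continuous

theorem isClosed_preimage_singleton {b : var F B} (hb : IsClosed {b}) :
    IsClosed (mor F φ ⁻¹' {b}) := hb.preimage (continuous_mor φ)

/-- The closed points are dense in `S`; being finitely many, they form a closed set and exhaust `S`.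
This makes points over closed points closed for morphisms with finite fibers. -/
theorem isClosed_singleton_of_mem_finite {S : Set (var F A)} (hS : IsClosed S) (hfin : S.Finite)
    {x : var F A} (hx : x ∈ S) : IsClosed {x} := by
  have h : IsClosed (S ∩ closedPoints (var F A)) := by
    rw [← Set.biUnion_of_singleton (S ∩ closedPoints (var F A))]
    exact (hfin.subset Set.inter_subset_left).isClosed_biUnion fun y hy => hy.2
  have h2 := JacobsonSpace.closure_inter_closedPoints hS
  rw [h.closure_eq] at h2
  rw [← h2] at hx
  exact hx.2

/-- Two closed subsets are comparable as soon as their closed points are. -/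
theorem subset_of_closedPoints {S T : Set (var F A)} (hS : IsClosed S) (hT : IsClosed T)
    (h : ∀ x ∈ S, IsClosed {x} → x ∈ T) : S ⊆ T := by
  rw [← JacobsonSpace.closure_inter_closedPoints hS]
  exact hT.closure_subset_iff.mpr fun x hx => h x hx.1 hx.2

theorem exists_specializes_isClosed (x : var F A) : ∃ y, x ⤳ y ∧ IsClosed {y} := by
  obtain ⟨y, hy, hy'⟩ := nonempty_inter_closedPoints (X := var F A) (Z := closure {x})
    ⟨x, subset_closure (Set.mem_singleton x)⟩ isClosed_closure.isLocallyClosed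
  exact ⟨y, specializes_iff_mem_closure.mpr hy, hy'⟩

theorem exists_isClosed_mem_of_mem_open {x : var F A} {U : Set (var F A)} (hU : IsOpen U)
    (hx : x ∈ U) : ∃ y ∈ U, x ⤳ y ∧ IsClosed {y} := by
  obtain ⟨y, hy, hy'⟩ := nonempty_inter_closedPoints (X := var F A) (Z := U ∩ closure {x})
    ⟨x, hx, subset_closure (Set.mem_singleton x)⟩
    (hU.isLocallyClosed.inter isClosed_closure.isLocallyClosed)
  exact ⟨y, hy.1, specializes_iff_mem_closure.mpr hy.2, hy'⟩

theorem exists_ht_le_add_ht (x : var F A) :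
    ∃ w, x ⤳ w ∧ IsClosed {mor F φ w} ∧ ht x ≤ ht (mor F φ x) + ht w := by
  obtain ⟨w, hw, hcl, h⟩ := exists_height_le_add_height (mor F φ) (str F B) x
  refine ⟨w, hw, hcl, ?_⟩
  rw [height_eq_ht, height_eq_ht, height_eq_ht] at h
  exact_mod_cast h

/-- Upper bound for the dimension of a closed set in terms of the fibers over closed points. -/
theorem dim_le_dim_add {M : Set (var F A)} {N : Set (var F B)} (hM : IsClosed M) (hN : IsClosed N)
    (hne : M.Nonempty) (hMN : Set.MapsTo (mor F φ) M N) {r : ℕ}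
    (h : ∀ w ∈ M, IsClosed {mor F φ w} → ht w ≤ r) : dim M ≤ dim N + r := by
  refine dim_le hM hne fun x hx => ?_
  obtain ⟨w, hw, hcl, hle⟩ := exists_ht_le_add_ht φ x
  exact hle.trans (add_le_add (ht_le_dim hN (hMN hx)) (h w (hw.mem_closed hM hx) hcl))

variable [IsAlgClosed K]

theorem exists_open_ht_add_ht_le (x : var F A) :
    ∃ U : Set (var F A), IsOpen U ∧ x ∈ U ∧ ∀ w ∈ U, x ⤳ w → IsClosed {mor F φ w} →
      ht w + ht (mor F φ x) ≤ ht x := by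
  obtain ⟨U, hU, hx, h⟩ := exists_open_height_add_height_le (mor F φ) (str F B) x
  refine ⟨U, hU, hx, fun w hw hxw hcl => ?_⟩
  have := h w hw hxw hcl
  rw [height_eq_ht, height_eq_ht, height_eq_ht] at this
  exact_mod_cast this

theorem ht_map_le (x : var F A) : ht (mor F φ x) ≤ ht x := by
  obtain ⟨U, hU, hx, h⟩ := exists_open_ht_add_ht_le φ x
  obtain ⟨y, hyU, hxy, hy⟩ := exists_isClosed_mem_of_mem_open hU hx
  have := h y hyU hxy (isClosed_map φ hy)
  omega

theorem ht_map_eq (hφ : HasFiniteFibers (mor F φ)) (x : var F A) : ht (mor F φ x) = ht x := by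
  refine le_antisymm (ht_map_le φ x) ?_
  obtain ⟨w, hw, hcl, hle⟩ := exists_ht_le_add_ht φ x
  have hw0 : ht w = 0 := ht_eq_zero_iff.mpr
    (isClosed_singleton_of_mem_finite (isClosed_preimage_singleton φ hcl) (hφ _) rfl)
  omega

/-- Lower bound for the dimension of a closed set in terms of a dense set of fibers. -/
theorem exists_ht_add_le (M : Closeds (var F A)) (v : var F B) (r : ℕ) (D : Set (var F A))
    (hDM : D ⊆ M) (hcl : ∀ w ∈ D, IsClosed {mor F φ w}) (hr : ∀ w ∈ D, r ≤ ht w)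
    (hv : ∀ w ∈ D, v ⤳ mor F φ w) (hvD : v ∈ closure (mor F φ '' D)) :
    ∃ x ∈ M, mor F φ x = v ∧ (∃ w ∈ D, x ⤳ w) ∧ ht v + r ≤ ht x := by
  -- Noetherian induction: either the generic point of `M` is the required point, or a part of `D`
  -- whose image still has `v` in its closure lies in a smaller closed set.
  induction M using WellFounded.induction (wellFounded_lt (α := Closeds (var F A)))
    generalizing D with
  | _ M ih =>
  have step : ∀ M' : Closeds (var F A), M' < M → v ∈ closure (mor F φ '' (D ∩ M')) →
      ∃ x ∈ M, mor F φ x = v ∧ (∃ w ∈ D, x ⤳ w) ∧ ht v + r ≤ ht x := by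
    intro M' hM' hvM'
    obtain ⟨x, hx, hxv, ⟨w, hw, hxw⟩, hle⟩ := ih M' hM' (D ∩ M') Set.inter_subset_right
      (fun w hw => hcl w hw.1) (fun w hw => hr w hw.1) (fun w hw => hv w hw.1) hvM'
    exact ⟨x, hM'.le hx, hxv, ⟨w, hw.1, hxw⟩, hle⟩
  have split : ∀ D' : Set (var F A), v ∈ closure (mor F φ '' (D ∩ D')) ∨
      v ∈ closure (mor F φ '' (D \ D')) := by
    intro D'
    rw [← Set.mem_union, ← closure_union, ← Set.image_union, Set.inter_union_sdiff]
    exact hvD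
  have hlt : ∀ Z : Set (var F A), IsClosed Z → ¬ (M : Set (var F A)) ⊆ Z →
      ∃ M' : Closeds (var F A), M' < M ∧ (M' : Set (var F A)) = (M : Set (var F A)) ∩ Z := by
    intro Z hZ hMZ
    refine ⟨⟨(M : Set (var F A)) ∩ Z, M.isClosed.inter hZ⟩, ?_, rfl⟩
    refine lt_iff_le_not_ge.mpr ⟨fun x hx => hx.1, fun h => hMZ fun x hx => (h hx).2⟩
  by_cases hirr : IsPreirreducible (M : Set (var F A))
  · have hneD : D.Nonempty := by
      rw [← Set.image_nonempty (f := mor F φ), ← closure_nonempty_iff]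
      exact ⟨v, hvD⟩
    have hirr' : IsIrreducible (M : Set (var F A)) := ⟨hneD.mono hDM, hirr⟩
    have hgen := hirr'.genericPoint_closure_eq
    rw [M.isClosed.closure_eq] at hgen
    set ξ := hirr'.genericPoint
    have hξM : ξ ∈ M := by
      have : ξ ∈ closure {ξ} := subset_closure rfl
      rwa [hgen] at this
    have hξ : ∀ w ∈ M, ξ ⤳ w := fun w hw => by
      rw [specializes_iff_mem_closure, hgen]
      exact hw
    have hξv : mor F φ ξ ⤳ v := by
      rw [specializes_iff_mem_closure]
      refine closure_minimal ?_ isClosed_closure hvD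
      rintro _ ⟨w, hw, rfl⟩
      exact specializes_iff_mem_closure.mp ((hξ w (hDM hw)).map (continuous_mor φ))
    by_cases hvξ : v ⤳ mor F φ ξ
    · have heq : mor F φ ξ = v := (hξv.antisymm hvξ).eq
      obtain ⟨U, hU, hξU, hle⟩ := exists_open_ht_add_ht_le φ ξ
      -- On `U` the generic upper bound for fiber dimensions, read backwards, is the wanted lower
      -- bound for `ξ`. A single point of `D ∩ U` suffices; otherwise `D \ U` is used.
      rcases split U with h | h
      · obtain ⟨w, hw⟩ : (D ∩ U).Nonempty := by
          rw [← Set.image_nonempty (f := mor F φ), ← closure_nonempty_iff]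
          exact ⟨v, h⟩
        refine ⟨ξ, hξM, heq, ⟨w, hw.1, hξ w (hDM hw.1)⟩, ?_⟩
        have h1 := hle w hw.2 (hξ w (hDM hw.1)) (hcl w hw.1)
        have h2 := hr w hw.1
        rw [heq] at h1
        omega
      · obtain ⟨M', hM', hM'eq⟩ := hlt Uᶜ hU.isClosed_compl fun h => h hξM hξU
        refine step M' hM' ?_
        have : D ∩ M' = D \ U := by
          rw [hM'eq, ← Set.inter_assoc, Set.inter_eq_left.mpr hDM]
          rfl
        rwa [this]
    -- Here `M` maps too far: all of `D` lies over the closure of `v`, so `M` may be cut down to the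
    -- preimage of that closure.
    · obtain ⟨M', hM', hM'eq⟩ := hlt (mor F φ ⁻¹' closure {v})
        (isClosed_closure.preimage (continuous_mor φ))
        fun h => hvξ (specializes_iff_mem_closure.mpr (h hξM))
      refine step M' hM' ?_
      have : D ∩ M' = D := by
        rw [hM'eq]
        exact Set.inter_eq_left.mpr
          fun w hw => ⟨hDM hw, specializes_iff_mem_closure.mp (hv w hw)⟩
      rwa [this]
  · rw [isPreirreducible_iff_isClosed_union_isClosed] at hirr
    push Not at hirr
    obtain ⟨Z₁, Z₂, hZ₁, hZ₂, hsub, h₁, h₂⟩ := hirr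
    obtain ⟨M₁, hM₁, hM₁eq⟩ := hlt Z₁ hZ₁ h₁
    obtain ⟨M₂, hM₂, hM₂eq⟩ := hlt Z₂ hZ₂ h₂
    rcases split Z₁ with h | h
    · refine step M₁ hM₁ ?_
      rwa [hM₁eq, ← Set.inter_assoc, Set.inter_eq_left.mpr hDM]
    · have hsub' : D \ Z₁ ⊆ D ∩ M₂ := fun w hw => ⟨hw.1, by
        rw [hM₂eq]
        exact ⟨hDM hw.1, (hsub (hDM hw.1)).resolve_left hw.2⟩⟩
      exact step M₂ hM₂ (closure_mono (Set.image_mono hsub') h)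

/-- If all fibers over the closed points of `N` have dimension `r`, then the dimension of the
preimage of `N` is `dim N + r`. -/
theorem dim_preimage {M : Set (var F A)} {N : Set (var F B)} (hM : IsClosed M) (hN : IsClosed N)
    (hne : N.Nonempty) (hMN : Set.MapsTo (mor F φ) M N) {r : ℕ}
    (h : ∀ y ∈ N, IsClosed {y} → (M ∩ mor F φ ⁻¹' {y}).Nonempty ∧ dim (M ∩ mor F φ ⁻¹' {y}) = r) :
    dim M = dim N + r := by
  have hcl : ∀ y, IsClosed {y} → IsClosed (M ∩ mor F φ ⁻¹' {y}) :=
    fun y hy => hM.inter (isClosed_preimage_singleton φ hy)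
  apply le_antisymm
  · refine dim_le_dim_add φ hM hN ?_ hMN fun w hw hwcl => ?_
    · obtain ⟨x, hx⟩ := hne
      obtain ⟨y, hxy, hy⟩ := exists_specializes_isClosed x
      exact (h y (hxy.mem_closed hN hx) hy).1.mono Set.inter_subset_left
    · rw [← (h _ (hMN hw) hwcl).2]
      exact ht_le_dim (hcl _ hwcl) ⟨hw, rfl⟩
  · obtain ⟨v, hvN, hv⟩ := exists_ht_eq_dim hN hne
    -- Here `v` has maximal height in `N`. Each closed point of its closure carries a point of
    -- height `r` in its fiber, so the image of `D` has `v` in its closure.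
    let D : Set (var F A) := {w | w ∈ M ∧ r ≤ ht w ∧ v ⤳ mor F φ w ∧ IsClosed {mor F φ w}}
    obtain ⟨x, hx, -, -, hle⟩ := exists_ht_add_le φ ⟨M, hM⟩ v r D (fun w hw => hw.1)
      (fun w hw => hw.2.2.2) (fun w hw => hw.2.1) (fun w hw => hw.2.2.1) (by
        have h1 : v ∈ closure (closure {v} ∩ closedPoints (var F B)) := by
          rw [JacobsonSpace.closure_inter_closedPoints isClosed_closure]
          exact subset_closure (Set.mem_singleton v)
        refine closure_mono ?_ h1
        rintro y ⟨hvy, hy⟩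
        have hvy' : v ⤳ y := specializes_iff_mem_closure.mpr hvy
        obtain ⟨hne, hdim⟩ := h y (hvy'.mem_closed hN hvN) hy
        obtain ⟨w, hw, hwr⟩ := exists_ht_eq_dim (hcl y hy) hne
        have hwy : mor F φ w = y := hw.2
        refine ⟨w, ⟨hw.1, ?_, ?_, ?_⟩, hwy⟩
        · rw [hwr, hdim]
        · rwa [hwy]
        · rwa [hwy])
    rw [← hv]
    exact hle.trans (ht_le_dim hM hx)

omit [IsAlgClosed K] in
/-- An infinite set of closed points is dense in the closure of a non-closed point. -/
theorem exists_mem_closure_of_infinite {D : Set (var F A)} (hD : D.Infinite) :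
    ∃ v : var F A, ¬ IsClosed {v} ∧ v ∈ closure (D ∩ closure {v}) := by
  -- A minimal closed set meeting `D` in an infinite set is irreducible, has `D ∩ N` dense in it,
  -- and is not a point; `v` is its generic point.
  obtain ⟨N, hN, hmin⟩ := (wellFounded_lt (α := Closeds (var F A))).has_min
    {N | (D ∩ (N : Set (var F A))).Infinite} ⟨⊤, by simpa using hD⟩
  have hN' : (D ∩ (N : Set (var F A))).Infinite := hN
  have hlt : ∀ Z : Set (var F A), IsClosed Z → (D ∩ (N ∩ Z)).Infinite →
      (N : Set (var F A)) ⊆ Z := by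
    intro Z hZ hinf
    by_contra hNZ
    refine hmin ⟨(N : Set (var F A)) ∩ Z, N.isClosed.inter hZ⟩ hinf (lt_iff_le_not_ge.mpr ⟨fun x hx => hx.1, ?_⟩)
    exact fun h => hNZ fun x hx => (h hx).2
  have hirr : IsPreirreducible (N : Set (var F A)) := by
    rw [isPreirreducible_iff_isClosed_union_isClosed]
    intro Z₁ Z₂ hZ₁ hZ₂ hsub
    have : D ∩ (N : Set (var F A)) = (D ∩ (N ∩ Z₁)) ∪ (D ∩ (N ∩ Z₂)) := by
      rw [← Set.inter_union_distrib_left, ← Set.inter_union_distrib_left,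
        Set.inter_eq_left.mpr hsub]
    rw [this, Set.infinite_union] at hN'
    exact hN'.imp (hlt Z₁ hZ₁) (hlt Z₂ hZ₂)
  have hirr' : IsIrreducible (N : Set (var F A)) :=
    ⟨hN'.nonempty.mono Set.inter_subset_right, hirr⟩
  have hgen := hirr'.genericPoint_closure_eq
  rw [N.isClosed.closure_eq] at hgen
  set ξ := hirr'.genericPoint
  refine ⟨ξ, fun hcl => ?_, ?_⟩
  · rw [hcl.closure_eq] at hgen
    rw [← hgen] at hN'
    exact hN' ((Set.finite_singleton ξ).subset Set.inter_subset_right)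
  · rw [hgen]
    have h1 : ξ ∈ closure {ξ} := subset_closure rfl
    rw [hgen] at h1
    refine hlt _ isClosed_closure (hN'.mono fun x hx => ⟨hx.1, hx.2, subset_closure hx⟩) h1

end Fibers

/-! ### Products, slices, and constancy of fiber dimensions -/

section Products

variable {K : Type u} [Field K] {C : Type v} [Category.{w} C] {F : C ⥤ VarietyCat K}

theorem mor_comp {X Y Z : C} (f : X ⟶ Y) (g : Y ⟶ Z) (x : var F X) :
    mor F (f ≫ g) x = mor F g (mor F f x) := by
  have : mor F (f ≫ g) = mor F f ≫ mor F g := by simp [mor]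
  rw [this]
  rfl

theorem range_mor_comp {X Y Z : C} (f : X ⟶ Y) (g : Y ⟶ Z) :
    Set.range (mor F (f ≫ g)) = mor F g '' Set.range (mor F f) := by
  ext z
  constructor
  · rintro ⟨x, rfl⟩
    exact ⟨_, ⟨x, rfl⟩, (mor_comp f g x).symm⟩
  · rintro ⟨_, ⟨x, rfl⟩, rfl⟩
    exact ⟨x, mor_comp f g x⟩

theorem HasFiniteFibers.comp_mor {X Y Z : C} {f : X ⟶ Y} {g : Y ⟶ Z}
    (hf : HasFiniteFibers (mor F f)) (hg : HasFiniteFibers (mor F g)) :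
    HasFiniteFibers (mor F (f ≫ g)) := by
  intro z
  have : mor F (f ≫ g) ⁻¹' {z} = ⋃ y ∈ mor F g ⁻¹' {z}, mor F f ⁻¹' {y} := by
    ext x
    simp [mor_comp]
  rw [this]
  exact (hg z).biUnion fun y _ => hf y

/-- The form in which (A1) and (A2) are used: two scheme points with the same image always come from
a point of the fiber product, which is covered by the images of the `A i`. -/
theorem exists_cover_fiberProduct (hF : IsDistinguished F) {X Y Z : C} (φ : X ⟶ Z) (ψ : Y ⟶ Z) :
    ∃ (n : ℕ) (A : Fin n → C) (a : ∀ i, A i ⟶ X) (b : ∀ i, A i ⟶ Y),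
      (∀ i t, mor F φ (mor F (a i) t) = mor F ψ (mor F (b i) t)) ∧
      ∀ x y, mor F φ x = mor F ψ y → ∃ i t, mor F (a i) t = x ∧ mor F (b i) t = y := by
  obtain ⟨P, pX, pY, hP⟩ := hF.directProducts X Y
  obtain ⟨n, A, f, h⟩ := hF.fiberedProducts X Y Z φ ψ P pX pY hP
  have hfst : hP.fromFiberProduct φ ψ ≫ mor F pX = pullback.fst _ _ := hP.isPullback.lift_fst _ _ _
  have hsnd : hP.fromFiberProduct φ ψ ≫ mor F pY = pullback.snd _ _ := hP.isPullback.lift_snd _ _ _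
  have hfst' : ∀ q, mor F pX (hP.fromFiberProduct φ ψ q) = pullback.fst (mor F φ) (mor F ψ) q :=
    fun q => by rw [← hfst]; rfl
  have hsnd' : ∀ q, mor F pY (hP.fromFiberProduct φ ψ q) = pullback.snd (mor F φ) (mor F ψ) q :=
    fun q => by rw [← hsnd]; rfl
  refine ⟨n, A, fun i => f i ≫ pX, fun i => f i ≫ pY, fun i t => ?_, fun x y hxy => ?_⟩
  · have : mor F (f i) t ∈ Set.range (hP.fromFiberProduct φ ψ) := by
      rw [← h]
      exact Set.mem_iUnion.mpr ⟨i, t, rfl⟩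
    obtain ⟨q, hq⟩ := this
    rw [mor_comp, mor_comp, ← hq, hfst', hsnd', ← Scheme.Hom.comp_apply, pullback.condition]
    rfl
  · obtain ⟨q, hq1, hq2⟩ := Scheme.Pullback.exists_preimage_pullback x y hxy
    have : hP.fromFiberProduct φ ψ q ∈ ⋃ i, Set.range (mor F (f i)) := by
      rw [h]
      exact ⟨q, rfl⟩
    obtain ⟨i, t, ht⟩ := Set.mem_iUnion.mp this
    refine ⟨i, t, ?_, ?_⟩
    · rw [mor_comp, ht, hfst', hq1]
    · rw [mor_comp, ht, hsnd', hq2]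

variable [IsAlgClosed K]

/-- A closed point `z` of `Z` induces a section `x ↦ (x, z)` of `X × Z → X`. -/
theorem exists_section {X Z P : C} {pX : P ⟶ X} {pZ : P ⟶ Z} (hP : IsDirectProduct F pX pZ)
    {z : var F Z} (hz : IsClosed {z}) :
    ∃ s : var F X ⟶ var F P, (∀ x, mor F pX (s x) = x) ∧ (∀ x, mor F pZ (s x) = z) ∧
      ∀ q, mor F pZ q = z → s (mor F pX q) = q := by
  let pt := pointOfClosedPoint (str F Z) z hz
  have hw : 𝟙 (var F X) ≫ str F X = (str F X ≫ pt) ≫ str F Z := by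
    simp [pt, pointOfClosedPoint_comp]
  let s := hP.isPullback.lift (𝟙 _) (str F X ≫ pt) hw
  have hs1 : s ≫ mor F pX = 𝟙 _ := hP.isPullback.lift_fst _ _ _
  have hs2 : s ≫ mor F pZ = str F X ≫ pt := hP.isPullback.lift_snd _ _ _
  have h1 : ∀ x, mor F pX (s x) = x := fun x => by
    rw [← Scheme.Hom.comp_apply, hs1]; rfl
  have h2 : ∀ x, mor F pZ (s x) = z := fun x => by
    rw [← Scheme.Hom.comp_apply, hs2, Scheme.Hom.comp_apply]
    exact pointOfClosedPoint_apply _ _ _ _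
  refine ⟨s, h1, h2, fun q hq => ?_⟩
  -- By pasting, `s` is the base change of the point `z` along the projection to `Z`, so its image
  -- is the whole set-theoretic fiber over `z`.
  have hbig : IsPullback (s ≫ mor F pX) (str F X) (str F X) (pt ≫ str F Z) := by
    rw [hs1, pointOfClosedPoint_comp]
    exact IsPullback.of_id_fst
  have hpb : IsPullback s (str F X) (mor F pZ) pt :=
    IsPullback.of_right hbig hs2 hP.isPullback
  obtain ⟨o⟩ : Nonempty (Spec (CommRingCat.of K)) := ⟨str F Z z⟩
  obtain ⟨x, hx, -⟩ := Scheme.exists_preimage_of_isPullback hpb q o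
    (hq.trans (pointOfClosedPoint_apply _ _ _ _).symm)
  have hx' : s x = q := hx
  rw [← hx', h1]

/-- Points of a product scheme are in general not determined by their projections. They are when one
projection is a closed, hence `K`-rational, point: that fiber is a copy of `X`. -/
theorem IsDirectProduct.eq_of_eq {X Z P : C} {pX : P ⟶ X} {pZ : P ⟶ Z}
    (hP : IsDirectProduct F pX pZ) {p q : var F P} (hX : mor F pX p = mor F pX q)
    (hZ : mor F pZ p = mor F pZ q) (hcl : IsClosed {mor F pZ q}) : p = q := by
  obtain ⟨s, -, -, h⟩ := exists_section hP hcl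
  rw [← h p hZ, ← h q rfl, hX]

/-- The set is the slice at `z` of the image of `(φ, ψ)` in the product, which is closed by (A4). -/
theorem isClosed_image_fiber (hF : IsDistinguished F) {X Y Z : C} (φ : Y ⟶ X) (ψ : Y ⟶ Z)
    {z : var F Z} (hz : IsClosed {z}) :
    IsClosed (mor F φ '' (mor F ψ ⁻¹' {z})) := by
  obtain ⟨P, pX, pZ, hP⟩ := hF.directProducts X Z
  obtain ⟨χ, h1, h2⟩ := hP.exists_lift Y φ ψ
  obtain ⟨s, hs1, hs2, hs3⟩ := exists_section hP hz
  have : mor F φ '' (mor F ψ ⁻¹' {z}) = s ⁻¹' Set.range (mor F χ) := by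
    ext x
    constructor
    · rintro ⟨y, hy, rfl⟩
      refine ⟨y, ?_⟩
      rw [← h1, mor_comp]
      exact (hs3 _ (by rw [← mor_comp, h2]; exact hy)).symm
    · rintro ⟨y, hy⟩
      refine ⟨y, ?_, ?_⟩
      · rw [Set.mem_preimage, ← h2, mor_comp, hy, hs2]; rfl
      · rw [← h1, mor_comp, hy, hs1]
  rw [this]
  exact (hF.isClosed_range _ _ χ).preimage s.continuous

/-- The fibers of a distinguished morphism over closed points of its image all have the same
dimension. -/
theorem exists_dim_fiber_eq (hF : IsDistinguished F) {A B : C} (g : A ⟶ B) :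
    ∃ e : ℕ, ∀ b ∈ Set.range (mor F g), IsClosed {b} → dim (mor F g ⁻¹' {b}) = e := by
  obtain ⟨W, Z, φ₁, φ₂, φ₃, hcomm, hfin, hsurj, hff, hirr, hdim⟩ := hF.fiberDimension A B g
  have hff₁ : HasFiniteFibers (mor F φ₁) := fun y => Scheme.Hom.finite_preimage_singleton _ y
  have hc : ∀ w, mor F g (mor F φ₁ w) = mor F φ₃ (mor F φ₂ w) := fun w => by
    rw [← mor_comp, hcomm, mor_comp]
  -- Only a reference value for the constant local dimension of (A4); `w₀` need not lie over a
  -- closed point.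
  let w₀ := genericPoint (var F W)
  have key : ∀ w, IsClosed {mor F φ₂ w} → ((dim (mor F φ₂ ⁻¹' {mor F φ₂ w}) : ℕ) : WithBot ℕ∞) =
      localDim (T := (mor F φ₂ ⁻¹' {mor F φ₂ w₀} : Set (var F W))) ⟨w₀, rfl⟩ := fun w hw => by
    rw [hdim w₀ w, localDim_eq_dim (isClosed_preimage_singleton φ₂ hw) (hirr _ ⟨w, rfl⟩)]
  obtain ⟨w₁, -, hw₁⟩ := exists_specializes_isClosed w₀
  refine ⟨dim (mor F φ₂ ⁻¹' {mor F φ₂ w₁}), ?_⟩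
  have key' : ∀ w, IsClosed {mor F φ₂ w} →
      dim (mor F φ₂ ⁻¹' {mor F φ₂ w}) = dim (mor F φ₂ ⁻¹' {mor F φ₂ w₁}) := fun w hw => by
    have := (key w hw).trans (key w₁ (isClosed_map φ₂ hw₁)).symm
    exact_mod_cast this
  rintro _ ⟨x₀, rfl⟩ hb
  -- The image of `w` in `Z` lies in a finite fiber of `φ₃` over a closed point. The fiber of `g` is
  -- thus covered by `φ₁`-images of fibers of `φ₂` over closed points, and `φ₁` preserves heights.
  have hcl : ∀ w, mor F g (mor F φ₁ w) = mor F g x₀ → IsClosed {mor F φ₂ w} := fun w hw =>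
    isClosed_singleton_of_mem_finite (isClosed_preimage_singleton φ₃ hb) (hff _)
      (by rw [Set.mem_preimage, ← hc, hw]; rfl)
  apply le_antisymm
  · refine dim_le (isClosed_preimage_singleton g hb) ⟨x₀, rfl⟩ fun x hx => ?_
    obtain ⟨w, rfl⟩ := hsurj.surj x
    rw [← key' w (hcl w hx)]
    exact (ht_map_le φ₁ w).trans
      (ht_le_dim (isClosed_preimage_singleton φ₂ (hcl w hx)) rfl)
  · obtain ⟨w, rfl⟩ := hsurj.surj x₀
    rw [← key' w (hcl w rfl)]
    obtain ⟨w', hw', hht⟩ := exists_ht_eq_dim (isClosed_preimage_singleton φ₂ (hcl w rfl)) ⟨w, rfl⟩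
    rw [← hht, ← ht_map_eq φ₁ hff₁]
    refine ht_le_dim (isClosed_preimage_singleton g hb) ?_
    rw [Set.mem_preimage, Set.mem_singleton_iff, hc, hc, show mor F φ₂ w' = mor F φ₂ w from hw']

theorem dim_preimage_of_subset_range (hF : IsDistinguished F) {A B : C} (g : A ⟶ B) :
    ∃ e : ℕ, (∀ b ∈ Set.range (mor F g), IsClosed {b} → dim (mor F g ⁻¹' {b}) = e) ∧
      ∀ N : Set (var F B), IsClosed N → N.Nonempty → N ⊆ Set.range (mor F g) →
        dim (mor F g ⁻¹' N) = dim N + e := by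
  obtain ⟨e, he⟩ := exists_dim_fiber_eq hF g
  refine ⟨e, he, fun N hN hne hsub => ?_⟩
  refine dim_preimage g (hN.preimage (continuous_mor g)) hN hne (fun _ h => h) fun y hy hcl => ?_
  have : mor F g ⁻¹' N ∩ mor F g ⁻¹' {y} = mor F g ⁻¹' {y} :=
    Set.inter_eq_right.mpr (Set.preimage_mono (Set.singleton_subset_iff.mpr hy))
  rw [this]
  obtain ⟨x, hx⟩ := hsub hy
  exact ⟨⟨x, hx⟩, he y (hsub hy) hcl⟩

theorem dim_univ_eq (hF : IsDistinguished F) {A B : C} (g : A ⟶ B) {b : var F B}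
    (hb : b ∈ Set.range (mor F g)) (hcl : IsClosed {b}) :
    dim (Set.univ : Set (var F A)) = dim (Set.range (mor F g)) + dim (mor F g ⁻¹' {b}) := by
  obtain ⟨e, he, h⟩ := dim_preimage_of_subset_range hF g
  rw [he b hb hcl, ← h _ (hF.isClosed_range _ _ g) ⟨b, hb⟩ subset_rfl, Set.preimage_range]

/-- For morphisms `a : A ⟶ X`, `b : A ⟶ Z`, the dimension of `a(A)` exceeds that of `a(b⁻¹(z))` by
as much as the dimension of `b(A)` exceeds that of `b(a⁻¹(x))`. -/
theorem dim_image_fiber_add (hF : IsDistinguished F) {A X Z : C} (a : A ⟶ X) (b : A ⟶ Z)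
    {x : var F X} {z : var F Z} (hx : IsClosed {x}) (hz : IsClosed {z})
    (hxa : x ∈ Set.range (mor F a)) (hzb : z ∈ Set.range (mor F b)) :
    dim (mor F a '' (mor F b ⁻¹' {z})) + dim (Set.range (mor F b)) =
      dim (mor F b '' (mor F a ⁻¹' {x})) + dim (Set.range (mor F a)) := by
  obtain ⟨P, pX, pZ, hP⟩ := hF.directProducts X Z
  obtain ⟨χ, h1, h2⟩ := hP.exists_lift A a b
  obtain ⟨e, he⟩ := exists_dim_fiber_eq hF χ
  have ha : ∀ t, mor F pX (mor F χ t) = mor F a t := fun t => by rw [← mor_comp, h1]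
  have hb : ∀ t, mor F pZ (mor F χ t) = mor F b t := fun t => by rw [← mor_comp, h2]
  -- The fiber of `(a, b)` over a pair of closed points is the intersection of the two fibers.
  have key : ∀ t, IsClosed {mor F a t} → IsClosed {mor F b t} →
      dim (mor F a ⁻¹' {mor F a t} ∩ mor F b ⁻¹' {mor F b t}) = e := by
    intro t hat hbt
    obtain ⟨t', ht', hcl⟩ := exists_specializes_isClosed t
    have hat' : mor F a t = mor F a t' :=
      ((ht'.map (continuous_mor a)).mem_closed hat rfl).symm
    have hbt' : mor F b t = mor F b t' :=
      ((ht'.map (continuous_mor b)).mem_closed hbt rfl).symm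
    have : mor F a ⁻¹' {mor F a t} ∩ mor F b ⁻¹' {mor F b t} = mor F χ ⁻¹' {mor F χ t'} := by
      ext y
      constructor
      · rintro ⟨hy1, hy2⟩
        refine hP.eq_of_eq ?_ ?_ ?_
        · rw [ha, ha, ← hat']; exact hy1
        · rw [hb, hb, ← hbt']; exact hy2
        · rw [hb, ← hbt']; exact hbt
      · intro hy
        have hy' : mor F χ y = mor F χ t' := hy
        refine ⟨?_, ?_⟩
        · rw [Set.mem_preimage, Set.mem_singleton_iff, ← ha y, hy', ha, hat']
        · rw [Set.mem_preimage, Set.mem_singleton_iff, ← hb y, hy', hb, hbt']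
    rw [this]
    exact he _ ⟨t', rfl⟩ (isClosed_map χ hcl)
  have hA : dim (mor F b ⁻¹' {z}) = dim (mor F a '' (mor F b ⁻¹' {z})) + e := by
    obtain ⟨t, rfl⟩ := hzb
    refine dim_preimage a (isClosed_preimage_singleton b hz) (isClosed_image_fiber hF a b hz)
      ⟨_, t, rfl, rfl⟩ (Set.mapsTo_image _ _) ?_
    rintro _ ⟨t', ht', rfl⟩ hcl
    have ht'' : mor F b t' = mor F b t := ht'
    refine ⟨⟨t', ht', rfl⟩, ?_⟩
    rw [Set.inter_comm, ← ht'']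
    exact key t' hcl (by rw [ht'']; exact hz)
  have hB : dim (mor F a ⁻¹' {x}) = dim (mor F b '' (mor F a ⁻¹' {x})) + e := by
    obtain ⟨t, rfl⟩ := hxa
    refine dim_preimage b (isClosed_preimage_singleton a hx) (isClosed_image_fiber hF b a hx)
      ⟨_, t, rfl, rfl⟩ (Set.mapsTo_image _ _) ?_
    rintro _ ⟨t', ht', rfl⟩ hcl
    have ht'' : mor F a t' = mor F a t := ht'
    refine ⟨⟨t', ht', rfl⟩, ?_⟩
    rw [← ht'']
    exact key t' (by rw [ht'']; exact hx) hcl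
  have hA' := dim_univ_eq hF b hzb hz
  have hB' := dim_univ_eq hF a hxa hx
  -- Both sides equal `dim A - e`.
  omega

/-- The case of `dim_image_fiber_add` in which the second morphism factors through the first, so
that its image of a fiber of `f` is a single point. -/
theorem dim_range_inter_fiber (hF : IsDistinguished F) {A Y Z : C} (f : A ⟶ Y) (ψ : Y ⟶ Z)
    {z : var F Z} (hz : IsClosed {z}) (hzf : z ∈ Set.range (mor F (f ≫ ψ))) :
    dim (Set.range (mor F f) ∩ mor F ψ ⁻¹' {z}) + dim (Set.range (mor F (f ≫ ψ))) =
      dim (Set.range (mor F f)) := by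
  obtain ⟨t, ht⟩ := exists_specializes_isClosed (genericPoint (var F A))
  have h := dim_image_fiber_add hF f (f ≫ ψ) (isClosed_map f ht.2) hz ⟨t, rfl⟩ hzf
  have h1 : mor F f '' (mor F (f ≫ ψ) ⁻¹' {z}) = Set.range (mor F f) ∩ mor F ψ ⁻¹' {z} := by
    ext y
    constructor
    · rintro ⟨s, hs, rfl⟩
      exact ⟨⟨s, rfl⟩, by rw [Set.mem_preimage, ← mor_comp]; exact hs⟩
    · rintro ⟨⟨s, rfl⟩, hs⟩
      exact ⟨s, by rw [Set.mem_preimage, mor_comp]; exact hs, rfl⟩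
  have h2 : mor F (f ≫ ψ) '' (mor F f ⁻¹' {mor F f t}) = {mor F (f ≫ ψ) t} := by
    apply subset_antisymm
    · rintro _ ⟨s, hs, rfl⟩
      rw [mor_comp, mor_comp, show mor F f s = mor F f t from hs]
      rfl
    · rintro _ rfl
      exact ⟨t, rfl, rfl⟩
  have h3 : dim {mor F (f ≫ ψ) t} = 0 := by
    have hcl := isClosed_map (f ≫ ψ) ht.2
    rw [← hcl.closure_eq, dim_closure_singleton, ht_eq_zero_iff]
    exact hcl
  rw [h1, h2, h3] at h
  omega

end Products

/-! ### Subvarieties, components and special hulls -/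

section Subvarieties

variable {K : Type u} [Field K] {C : Type v} [Category.{w} C] {F : C ⥤ VarietyCat K} {X : C}

/-- The generic point of a subvariety. -/
def gen (V : Subvar F X) : var F X := V.isIrreducible.genericPoint

theorem closure_gen (V : Subvar F X) : closure {gen V} = (V : Set (var F X)) := by
  have := V.isIrreducible.genericPoint_closure_eq
  rwa [V.isClosed.closure_eq] at this

theorem gen_mem (V : Subvar F X) : gen V ∈ (V : Set (var F X)) := by
  rw [← closure_gen]
  exact subset_closure rfl

theorem subset_iff_gen_mem {V : Subvar F X} {S : Set (var F X)} (hS : IsClosed S) :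
    (V : Set (var F X)) ⊆ S ↔ gen V ∈ S := by
  rw [← closure_gen, hS.closure_subset_iff, Set.singleton_subset_iff]

theorem le_iff_gen_mem {V W : Subvar F X} : V ≤ W ↔ gen V ∈ (W : Set (var F X)) :=
  subset_iff_gen_mem W.isClosed

theorem dim_eq_ht_gen (V : Subvar F X) : dim (V : Set (var F X)) = ht (gen V) := by
  rw [← closure_gen, dim_closure_singleton]

variable (F) in
/-- The subvariety with generic point `x`. -/
def ofPoint (x : var F X) : Subvar F X where
  carrier := closure {x}
  isIrreducible' := isIrreducible_singleton.closure
  isClosed' := isClosed_closure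

theorem coe_ofPoint (x : var F X) : (ofPoint F x : Set (var F X)) = closure {x} := rfl

theorem mem_ofPoint (x : var F X) : x ∈ (ofPoint F x : Set (var F X)) := subset_closure rfl

theorem ofPoint_gen (V : Subvar F X) : ofPoint F (gen V) = V :=
  SetLike.coe_injective (closure_gen V)

theorem gen_ofPoint (x : var F X) : gen (ofPoint F x) = x := by
  have h := closure_gen (ofPoint F x)
  rw [coe_ofPoint] at h
  refine Specializes.antisymm ?_ ?_ |>.eq <;>
  rw [specializes_iff_closure_subset, h]

theorem ofPoint_le_iff {x : var F X} {V : Subvar F X} :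
    ofPoint F x ≤ V ↔ x ∈ (V : Set (var F X)) := by
  rw [le_iff_gen_mem, gen_ofPoint]

theorem dim_le_of_le {V W : Subvar F X} (h : V ≤ W) :
    dim (V : Set (var F X)) ≤ dim (W : Set (var F X)) :=
  dim_mono V.isClosed W.isClosed V.isIrreducible.1 h

theorem eq_of_le_of_dim_le {V W : Subvar F X} (h : V ≤ W)
    (hd : dim (W : Set (var F X)) ≤ dim (V : Set (var F X))) : V = W := by
  rw [dim_eq_ht_gen, dim_eq_ht_gen] at hd
  rw [← ofPoint_gen V, ← ofPoint_gen W]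
  congr 1
  by_contra hne
  have := ht_lt_of_specializes (x := gen W) (y := gen V)
    (by rw [specializes_iff_mem_closure, closure_gen]; exact le_iff_gen_mem.mp h) (Ne.symm hne)
  omega

theorem dim_lt_of_lt {V W : Subvar F X} (h : V < W) :
    dim (V : Set (var F X)) < dim (W : Set (var F X)) := by
  by_contra hle
  exact h.ne (eq_of_le_of_dim_le h.le (not_lt.mp hle))

theorem isComponentOf_self {V : Set (var F X)} (h : IsIrreducible V) : IsComponentOf V V :=
  ⟨⟨h, subset_rfl⟩, fun _ hU _ => hU.2⟩

theorem exists_isComponentOf {S : Set (var F X)} (hS : IsClosed S) {y : var F X} (hy : y ∈ S) :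
    ∃ V : Subvar F X, y ∈ (V : Set (var F X)) ∧ IsComponentOf (V : Set (var F X)) S := by
  have hbdd : BddAbove (ht '' {x | x ∈ S ∧ x ⤳ y}) := by
    refine ⟨dim S, ?_⟩
    rintro _ ⟨x, hx, rfl⟩
    exact ht_le_dim hS hx.1
  obtain ⟨x, ⟨hxS, hxy⟩, hmax⟩ := Nat.sSup_mem
    (Set.Nonempty.image ht (s := {x | x ∈ S ∧ x ⤳ y}) ⟨y, hy, specializes_rfl⟩) hbdd
  refine ⟨ofPoint F x, specializes_iff_mem_closure.mp hxy, ⟨(ofPoint F x).isIrreducible, ?_⟩, ?_⟩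
  · exact hS.closure_subset_iff.mpr (Set.singleton_subset_iff.mpr hxS)
  · rintro U ⟨hU, hUS⟩ hxU
    let U' : Subvar F X := ⟨closure U, hU.closure, isClosed_closure⟩
    have hle : ofPoint F x ≤ U' := hxU.trans subset_closure
    have hgS : gen U' ∈ S := hS.closure_subset_iff.mpr hUS (gen_mem U')
    have hgx : gen U' ⤳ x := by
      rw [specializes_iff_mem_closure, closure_gen]
      exact hle (mem_ofPoint x)
    have hht : ht (gen U') ≤ ht x := by
      rw [hmax]
      exact le_csSup hbdd ⟨_, ⟨hgS, hgx.trans hxy⟩, rfl⟩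
    have : ofPoint F x = U' := by
      refine eq_of_le_of_dim_le hle ?_
      rw [dim_eq_ht_gen, dim_eq_ht_gen, gen_ofPoint]
      exact hht
    exact subset_closure.trans (show (U' : Set (var F X)) ⊆ ofPoint F x by rw [this])

theorem finite_isComponentOf {S : Set (var F X)} (hS : IsClosed S) :
    {V : Subvar F X | IsComponentOf (V : Set (var F X)) S}.Finite := by
  obtain ⟨T, hfin, hcl, hirr, hST⟩ := NoetherianSpace.exists_finite_set_isClosed_irreducible hS
  refine Set.Finite.of_finite_image (f := fun V : Subvar F X => (V : Set (var F X)))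
    (hfin.subset ?_) SetLike.coe_injective.injOn
  rintro _ ⟨V, hV, rfl⟩
  have hg : gen V ∈ ⋃₀ T := by
    rw [← hST]
    exact hV.1.2 (gen_mem V)
  obtain ⟨t, ht, hgt⟩ := hg
  have hVt : (V : Set (var F X)) ⊆ t := (subset_iff_gen_mem (hcl t ht)).mpr hgt
  have htV : t ⊆ V := hV.2 ⟨hirr t ht, by rw [hST]; exact Set.subset_sUnion_of_mem ht⟩ hVt
  have : (V : Set (var F X)) = t := hVt.antisymm htV
  change (V : Set (var F X)) ∈ T
  rw [this]
  exact ht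

/-- A property of subvarieties that is stable under passing to suitable subvarieties of
intersections admits smallest elements. -/
theorem exists_isLeast_of_directed (p : Subvar F X → Prop) (V : Subvar F X)
    (h₀ : p (wholeVar X))
    (h : ∀ S S', p S → p S' → V ≤ S → V ≤ S' → ∃ S'', p S'' ∧ V ≤ S'' ∧ S'' ≤ S ∧ S'' ≤ S') :
    ∃ S, IsLeast {S : Subvar F X | p S ∧ V ≤ S} S := by
  obtain ⟨S, hS, hmin⟩ := (measure fun S : Subvar F X => dim (S : Set (var F X))).wf.has_min
    {S : Subvar F X | p S ∧ V ≤ S} ⟨wholeVar X, h₀, fun _ _ => trivial⟩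
  refine ⟨S, hS, fun S' hS' => ?_⟩
  obtain ⟨S'', h1, h2, h3, h4⟩ := h S S' hS.1 hS'.1 hS.2 hS'.2
  have : S'' = S := eq_of_le_of_dim_le h3 (not_lt.mp (hmin S'' ⟨h1, h2⟩))
  rwa [this] at h4

/-- The image of a distinguished morphism, as a subvariety. -/
def rangeVar (hF : IsDistinguished F) {Y : C} (φ : Y ⟶ X) : Subvar F X where
  carrier := Set.range (mor F φ)
  isIrreducible' := by
    rw [← Set.image_univ]
    exact ((irreducibleSpace_def _).mp inferInstance).image _ (continuous_mor φ).continuousOn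
  isClosed' := hF.isClosed_range _ _ φ

theorem coe_rangeVar (hF : IsDistinguished F) {Y : C} (φ : Y ⟶ X) :
    (rangeVar hF φ : Set (var F X)) = Set.range (mor F φ) := rfl

theorem isSpecial_rangeVar (hF : IsDistinguished F) {Y : C} (φ : Y ⟶ X) :
    IsSpecial (rangeVar hF φ) := ⟨Y, φ, rfl⟩

theorem isSpecial_wholeVar : IsSpecial (wholeVar X : Subvar F X) := by
  refine ⟨X, 𝟙 X, ?_⟩
  have : mor F (𝟙 X) = 𝟙 _ := by simp [mor]
  rw [this]
  exact (Set.range_id (α := var F X)).symm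

/-- By (A2) the preimage of a special subvariety is a finite union of special ones; `a` parametrizes
a member containing `y`. -/
theorem exists_special_of_mem_range (hF : IsDistinguished F) {Y Y' : C} (φ : Y ⟶ X) (f : Y' ⟶ X)
    {y : var F Y} (hy : mor F φ y ∈ Set.range (mor F f)) :
    ∃ (A : C) (a : A ⟶ Y), y ∈ Set.range (mor F a) ∧
      Set.range (mor F (a ≫ φ)) ⊆ Set.range (mor F f) := by
  obtain ⟨n, A, a, b, h1, h2⟩ := exists_cover_fiberProduct hF φ f
  obtain ⟨y', hy'⟩ := hy
  obtain ⟨i, t, ht, -⟩ := h2 y y' hy'.symm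
  refine ⟨A i, a i, ⟨t, ht⟩, ?_⟩
  rintro _ ⟨s, rfl⟩
  exact ⟨mor F (b i) s, by rw [mor_comp, h1]⟩

theorem isLeast_specialHull (hF : IsDistinguished F) (V : Subvar F X) :
    IsLeast {S : Subvar F X | IsSpecial S ∧ V ≤ S} (specialHull V) := by
  have h : ∃ S, IsLeast {S : Subvar F X | IsSpecial S ∧ V ≤ S} S := by
    refine exists_isLeast_of_directed _ V isSpecial_wholeVar ?_
    rintro S S' ⟨Y, φ, hφ⟩ ⟨Y', f, hf⟩ hVS hVS'
    have h1 := le_iff_gen_mem.mp hVS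
    have h2 := le_iff_gen_mem.mp hVS'
    rw [hφ] at h1
    rw [hf] at h2
    obtain ⟨y, hy⟩ := h1
    rw [← hy] at h2
    obtain ⟨A, a, ha, haf⟩ := exists_special_of_mem_range hF φ f h2
    refine ⟨rangeVar hF (a ≫ φ), isSpecial_rangeVar hF _, ?_, ?_, ?_⟩
    · rw [le_iff_gen_mem, coe_rangeVar, range_mor_comp, ← hy]
      exact ⟨y, ha, rfl⟩
    · rw [← SetLike.coe_subset_coe, hφ, coe_rangeVar, range_mor_comp]
      exact Set.image_subset_range _ _
    · rw [← SetLike.coe_subset_coe, hf]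
      exact haf
  rw [specialHull, dif_pos h]
  exact h.choose_spec

theorem le_specialHull (hF : IsDistinguished F) (V : Subvar F X) : V ≤ specialHull V :=
  (isLeast_specialHull hF V).1.2

theorem exists_specialHull_eq_range (hF : IsDistinguished F) (V : Subvar F X) :
    ∃ (Y : C) (φ : Y ⟶ X), (specialHull V : Set (var F X)) = Set.range (mor F φ) :=
  (isLeast_specialHull hF V).1.1

theorem specialHull_subset_range (hF : IsDistinguished F) {V : Subvar F X} {Y : C} (φ : Y ⟶ X)
    (h : gen V ∈ Set.range (mor F φ)) : (specialHull V : Set (var F X)) ⊆ Set.range (mor F φ) :=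
  have hle : specialHull V ≤ rangeVar hF φ :=
    (isLeast_specialHull hF V).2 ⟨isSpecial_rangeVar hF φ, le_iff_gen_mem.mpr h⟩
  hle

theorem IsSpecial.isWeaklySpecial (hF : IsDistinguished F) {V : Subvar F X} (h : IsSpecial V) :
    IsWeaklySpecial V := by
  obtain ⟨Y, φ, hφ⟩ := h
  obtain ⟨T, ⟨hT⟩, hiso⟩ := hF.finalObject
  have huniq : ∀ t t' : var F T, t = t' := fun t t' => by
    let e := Scheme.homeoOfIso (asIso (str F T))
    exact e.injective (Subsingleton.elim (α := PrimeSpectrum K) _ _)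
  let t₀ := genericPoint (var F T)
  have h0 : mor F (hT.from Y) ⁻¹' {t₀} = Set.univ := by
    ext y
    simpa using huniq _ _
  refine ⟨Y, T, hT.from Y, φ, t₀, ?_, ?_⟩
  · have : ({t₀} : Set (var F T)) = Set.univ := by
      ext t
      simpa using huniq _ _
    change IsClosed {t₀}
    rw [this]
    exact isClosed_univ
  · rw [h0, Set.image_univ, ← hφ]
    exact isComponentOf_self V.isIrreducible

end Subvarieties

/-! ### Weakly special hulls, and why optimal implies weakly optimal -/

section WeaklySpecial

variable {K : Type u} [Field K] [IsAlgClosed K] {C : Type v} [Category.{w} C]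
  {F : C ⥤ VarietyCat K} {X : C}

/-- All components of the sets `φ(ψ⁻¹(z))` can be obtained as images of fibers of a morphism with
irreducible fibers. -/
theorem exists_irreducible_presentation (hF : IsDistinguished F) {Y Z : C} (ψ : Y ⟶ Z) :
    ∃ (W Z' : C) (φ₁ : W ⟶ Y) (ψ' : W ⟶ Z'), HasFiniteFibers (mor F φ₁) ∧
      (∀ z ∈ Set.range (mor F ψ'), IsIrreducible (mor F ψ' ⁻¹' {z})) ∧
      ∀ (X : C) (φ : Y ⟶ X) (z : var F Z) (V : Subvar F X), IsClosed {z} →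
        IsComponentOf (V : Set (var F X)) (mor F φ '' (mor F ψ ⁻¹' {z})) →
        ∃ z' ∈ Set.range (mor F ψ'), IsClosed {z'} ∧
          (V : Set (var F X)) = mor F (φ₁ ≫ φ) '' (mor F ψ' ⁻¹' {z'}) := by
  obtain ⟨W, Z', φ₁, φ₂, φ₃, hcomm, hfin, hsurj, hff, hirr, -⟩ := hF.fiberDimension Y Z ψ
  refine ⟨W, Z', φ₁, φ₂, fun y => Scheme.Hom.finite_preimage_singleton _ y, hirr,
    fun X φ z V hz hV => ?_⟩
  have hc : ∀ w, mor F ψ (mor F φ₁ w) = mor F φ₃ (mor F φ₂ w) := fun w => by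
    rw [← mor_comp, hcomm, mor_comp]
  -- A lift of the generic point of `V` to `W` selects the fiber of `φ₂`. Its image is irreducible,
  -- contains `V` and stays in `φ(ψ⁻¹(z))`, so it equals the component `V`.
  obtain ⟨y, hy, hgen⟩ := hV.1.2 (gen_mem V)
  obtain ⟨w, rfl⟩ := hsurj.surj y
  have hw : mor F φ₃ (mor F φ₂ w) = z := (hc w).symm.trans hy
  have hcl : IsClosed {mor F φ₂ w} :=
    isClosed_singleton_of_mem_finite (isClosed_preimage_singleton φ₃ hz) (hff z) hw
  refine ⟨_, ⟨w, rfl⟩, hcl, ?_⟩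
  have hle : (V : Set (var F X)) ⊆ mor F (φ₁ ≫ φ) '' (mor F φ₂ ⁻¹' {mor F φ₂ w}) := by
    rw [subset_iff_gen_mem (isClosed_image_fiber hF _ _ hcl)]
    exact ⟨w, rfl, by rw [mor_comp, hgen]⟩
  refine hle.antisymm (hV.2 ⟨(hirr _ ⟨w, rfl⟩).image _ (continuous_mor _).continuousOn, ?_⟩ hle)
  rintro _ ⟨w', hw', rfl⟩
  refine ⟨mor F φ₁ w', ?_, (mor_comp _ _ _).symm⟩
  rw [Set.mem_preimage, Set.mem_singleton_iff, hc, show mor F φ₂ w' = mor F φ₂ w from hw', hw]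

theorem IsWeaklySpecial.exists_eq_image (hF : IsDistinguished F) {V : Subvar F X}
    (h : IsWeaklySpecial V) :
    ∃ (Y Z : C) (φ : Y ⟶ X) (ψ : Y ⟶ Z),
      (∀ z ∈ Set.range (mor F ψ), IsIrreducible (mor F ψ ⁻¹' {z})) ∧
      ∃ z ∈ Set.range (mor F ψ), IsClosed {z} ∧
        (V : Set (var F X)) = mor F φ '' (mor F ψ ⁻¹' {z}) := by
  obtain ⟨Y, Z, ψ, φ, z, hz, hV⟩ := h
  obtain ⟨W, Z', φ₁, ψ', -, hirr, h⟩ := exists_irreducible_presentation hF ψ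
  exact ⟨W, Z', φ₁ ≫ φ, ψ', hirr, h X φ z V hz hV⟩

/-- The intersection of φ(ψ⁻¹(z)) and φ'(ψ'⁻¹(z')) is covered by images of fibers over (z, z') of
maps from pieces of the fiber product of φ and φ' to Z × Z'. -/
theorem isLeast_weaklySpecialHull (hF : IsDistinguished F) (V : Subvar F X) :
    IsLeast {S : Subvar F X | IsWeaklySpecial S ∧ V ≤ S} (weaklySpecialHull V) := by
  have h : ∃ S, IsLeast {S : Subvar F X | IsWeaklySpecial S ∧ V ≤ S} S := by
    refine exists_isLeast_of_directed _ V (isSpecial_wholeVar.isWeaklySpecial hF) ?_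
    intro S S' hS hS' hVS hVS'
    obtain ⟨Y, Z, φ, ψ, -, z, -, hz, hSeq⟩ := hS.exists_eq_image hF
    obtain ⟨Y', Z', φ', ψ', -, z', -, hz', hSeq'⟩ := hS'.exists_eq_image hF
    have h1 := le_iff_gen_mem.mp hVS
    have h2 := le_iff_gen_mem.mp hVS'
    rw [hSeq] at h1
    rw [hSeq'] at h2
    obtain ⟨y, hy, hyV⟩ := h1
    obtain ⟨y', hy', hyV'⟩ := h2
    obtain ⟨n, A, a, b, hab, hcov⟩ := exists_cover_fiberProduct hF φ φ'
    obtain ⟨i, t, rfl, rfl⟩ := hcov y y' (hyV.trans hyV'.symm)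
    obtain ⟨P, pZ, pZ', hP⟩ := hF.directProducts Z Z'
    obtain ⟨χ, hχ1, hχ2⟩ := hP.exists_lift (A i) (a i ≫ ψ) (b i ≫ ψ')
    have hpa : ∀ s, mor F pZ (mor F χ s) = mor F ψ (mor F (a i) s) := fun s => by
      rw [← mor_comp, hχ1, mor_comp]
    have hpb : ∀ s, mor F pZ' (mor F χ s) = mor F ψ' (mor F (b i) s) := fun s => by
      rw [← mor_comp, hχ2, mor_comp]
    obtain ⟨t', ht', hcl⟩ := exists_specializes_isClosed t
    have hta : mor F ψ (mor F (a i) t') = z :=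
      (ht'.map ((continuous_mor ψ).comp (continuous_mor (a i)))).mem_closed hz hy
    have htb : mor F ψ' (mor F (b i) t') = z' :=
      (ht'.map ((continuous_mor ψ').comp (continuous_mor (b i)))).mem_closed hz' hy'
    -- The point `t` need not be closed, but it lies over the closed points `z` and `z'`, so its
    -- image in the product is closed and agrees with that of `t'`.
    have hχt : mor F χ t = mor F χ t' := by
      refine hP.eq_of_eq ?_ ?_ ?_
      · rw [hpa, hpa, hta]; exact hy
      · rw [hpb, hpb, htb]; exact hy'
      · rw [hpb, htb]; exact hz'
    have hE := isClosed_image_fiber hF (a i ≫ φ) χ (isClosed_map χ hcl)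
    obtain ⟨S'', hVS'', hcomp⟩ := exists_isComponentOf hE (y := gen V)
      ⟨t, hχt, by rw [mor_comp, hyV]⟩
    refine ⟨S'', ⟨_, _, χ, a i ≫ φ, _, isClosed_map χ hcl, hcomp⟩, le_iff_gen_mem.mpr hVS'', ?_, ?_⟩
    · rw [← SetLike.coe_subset_coe, hSeq]
      refine hcomp.1.2.trans ?_
      rintro _ ⟨s, hs, rfl⟩
      refine ⟨mor F (a i) s, ?_, (mor_comp _ _ _).symm⟩
      rw [Set.mem_preimage, Set.mem_singleton_iff, ← hpa, show mor F χ s = mor F χ t' from hs,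
        hpa, hta]
    · rw [← SetLike.coe_subset_coe, hSeq']
      refine hcomp.1.2.trans ?_
      rintro _ ⟨s, hs, rfl⟩
      refine ⟨mor F (b i) s, ?_, by rw [mor_comp, hab]⟩
      rw [Set.mem_preimage, Set.mem_singleton_iff, ← hpb, show mor F χ s = mor F χ t' from hs,
        hpb, htb]
  rw [weaklySpecialHull, dif_pos h]
  exact h.choose_spec

theorem le_weaklySpecialHull (hF : IsDistinguished F) (V : Subvar F X) : V ≤ weaklySpecialHull V :=
  (isLeast_weaklySpecialHull hF V).1.2

theorem weaklySpecialHull_le_specialHull (hF : IsDistinguished F) (V : Subvar F X) :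
    weaklySpecialHull V ≤ specialHull V :=
  (isLeast_weaklySpecialHull hF V).2
    ⟨(isLeast_specialHull hF V).1.1.isWeaklySpecial hF, le_specialHull hF V⟩

theorem dim_weaklySpecialHull_le (hF : IsDistinguished F) {V : Subvar F X} {Y Z : C} (φ : Y ⟶ X)
    (ψ : Y ⟶ Z) {z : var F Z} (hz : IsClosed {z}) (h : gen V ∈ mor F φ '' (mor F ψ ⁻¹' {z})) :
    dim (weaklySpecialHull V : Set (var F X)) ≤ dim (mor F φ '' (mor F ψ ⁻¹' {z})) := by
  obtain ⟨S, hVS, hcomp⟩ := exists_isComponentOf (isClosed_image_fiber hF φ ψ hz) h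
  have h1 : weaklySpecialHull V ≤ S := (isLeast_weaklySpecialHull hF V).2
    ⟨⟨_, _, ψ, φ, z, hz, hcomp⟩, le_iff_gen_mem.mpr hVS⟩
  exact (dim_le_of_le h1).trans (dim_mono S.isClosed (isClosed_image_fiber hF φ ψ hz)
    S.isIrreducible.1 hcomp.1.2)

/-- If all fibers of `ψ` over its image are irreducible, then preimages of special subvarieties of
the image are special. -/
theorem exists_range_eq_preimage (hF : IsDistinguished F) {Y Z B : C} (ψ : Y ⟶ Z) (f : B ⟶ Z)
    (hirr : ∀ z ∈ Set.range (mor F ψ), IsIrreducible (mor F ψ ⁻¹' {z}))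
    (hf : Set.range (mor F f) ⊆ Set.range (mor F ψ)) :
    ∃ (A : C) (a : A ⟶ Y), Set.range (mor F a) = mor F ψ ⁻¹' Set.range (mor F f) := by
  obtain ⟨n, A, a, b, hab, hcov⟩ := exists_cover_fiberProduct hF ψ f
  obtain ⟨e, he⟩ := exists_dim_fiber_eq hF ψ
  set R := rangeVar hF f with hR
  have hRf : (R : Set (var F Z)) = Set.range (mor F f) := rfl
  have hMcl : IsClosed (mor F ψ ⁻¹' (R : Set (var F Z))) := R.isClosed.preimage (continuous_mor ψ)
  -- A point of the preimage over the generic point of `R`, of height at least `dim R + e`. The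
  -- piece of the fiber product through it is large enough to fill every fiber.
  obtain ⟨x, hxM, hx, -, hht⟩ := exists_ht_add_le ψ ⟨mor F ψ ⁻¹' (R : Set (var F Z)), hMcl⟩ (gen R) e
    {w | mor F ψ w ∈ (R : Set (var F Z)) ∧ IsClosed {mor F ψ w} ∧ e ≤ ht w}
    (fun w hw => hw.1) (fun w hw => hw.2.1) (fun w hw => hw.2.2)
    (fun w hw => by rw [specializes_iff_mem_closure, closure_gen]; exact hw.1)
    (by
      have h1 : (R : Set (var F Z)) ∩ closedPoints (var F Z) ⊆ mor F ψ ''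
          {w | mor F ψ w ∈ (R : Set (var F Z)) ∧ IsClosed {mor F ψ w} ∧ e ≤ ht w} := by
        rintro z ⟨hzR, hz⟩
        have hzcl : IsClosed {z} := hz
        obtain ⟨y, rfl⟩ := hf hzR
        obtain ⟨w, hw, hw'⟩ := exists_ht_eq_dim (isClosed_preimage_singleton ψ hzcl) ⟨y, rfl⟩
        have hwy : mor F ψ w = mor F ψ y := hw
        refine ⟨w, ⟨by rw [hwy]; exact hzR, by rw [hwy]; exact hzcl, ?_⟩, hwy⟩
        rw [hw', he _ ⟨y, rfl⟩ hzcl]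
      refine closure_mono h1 ?_
      rw [JacobsonSpace.closure_inter_closedPoints R.isClosed]
      exact gen_mem R)
  have hgR : gen R ∈ Set.range (mor F f) := gen_mem R
  obtain ⟨y', hy'⟩ := hgR
  obtain ⟨i, t, htx, -⟩ := hcov x y' (hx.trans hy'.symm)
  have hQsub : Set.range (mor F (a i)) ⊆ mor F ψ ⁻¹' Set.range (mor F f) := by
    rintro _ ⟨s, rfl⟩
    exact ⟨mor F (b i) s, (hab i s).symm⟩
  have hQR : Set.range (mor F (a i ≫ ψ)) = (R : Set (var F Z)) := by
    apply subset_antisymm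
    · rintro _ ⟨s, rfl⟩
      rw [mor_comp]
      exact hQsub ⟨s, rfl⟩
    · rw [subset_iff_gen_mem (hF.isClosed_range _ _ _)]
      exact ⟨t, by rw [mor_comp, htx, hx]⟩
  refine ⟨A i, a i, hQsub.antisymm ?_⟩
  refine subset_of_closedPoints hMcl (hF.isClosed_range _ _ _) fun y hy hycl => ?_
  have hcl := isClosed_map ψ hycl
  have hd := dim_range_inter_fiber hF (a i) ψ hcl (by rw [hQR]; exact hy)
  have hx' : ht x ≤ dim (Set.range (mor F (a i))) :=
    ht_le_dim (hF.isClosed_range _ _ _) ⟨t, htx⟩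
  rw [hQR, dim_eq_ht_gen] at hd
  have hclQ : IsClosed (Set.range (mor F (a i)) ∩ mor F ψ ⁻¹' {mor F ψ y}) :=
    (hF.isClosed_range _ _ _).inter (isClosed_preimage_singleton ψ hcl)
  have hne : (Set.range (mor F (a i)) ∩ mor F ψ ⁻¹' {mor F ψ y}).Nonempty := by
    have : mor F ψ y ∈ Set.range (mor F (a i ≫ ψ)) := by rw [hQR]; exact hy
    obtain ⟨s, hs⟩ := this
    exact ⟨mor F (a i) s, ⟨s, rfl⟩, by rw [Set.mem_preimage, ← mor_comp, hs]; rfl⟩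
  obtain ⟨q, hq, hq'⟩ := exists_ht_eq_dim hclQ hne
  let V : Subvar F Y := ⟨mor F ψ ⁻¹' {mor F ψ y}, hirr _ ⟨y, rfl⟩, isClosed_preimage_singleton ψ hcl⟩
  have hqV : ofPoint F q ≤ V := ofPoint_le_iff.mpr hq.2
  have hVdim : dim (V : Set (var F Y)) = e := he _ ⟨y, rfl⟩ hcl
  -- The fibers of the chosen piece over `R` have dimension at least `e`, while the fiber of `ψ` is
  -- irreducible of dimension `e`; so it is contained in the piece.
  have heq : ofPoint F q = V := by
    refine eq_of_le_of_dim_le hqV ?_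
    rw [hVdim, dim_eq_ht_gen, gen_ofPoint]
    omega
  have hyV : y ∈ (V : Set (var F Y)) := rfl
  rw [← heq] at hyV
  exact (specializes_iff_mem_closure.mpr hyV).mem_closed (hF.isClosed_range _ _ _) hq.1

/-- The difference between the dimensions of the special and the weakly special hull is
decreasing. -/
theorem defect_sub_weakDefect_le (hF : IsDistinguished F) {W U : Subvar F X} (hWU : W ≤ U) :
    defect U - weakDefect U ≤ defect W - weakDefect W := by
  obtain ⟨Y, Z, φ, ψ, hirr, z, hzψ, hz, hU⟩ :=
    (isLeast_weaklySpecialHull hF U).1.1.exists_eq_image hF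
  have hW : gen W ∈ mor F φ '' (mor F ψ ⁻¹' {z}) := by
    rw [← hU]
    exact le_iff_gen_mem.mp (hWU.trans (le_weaklySpecialHull hF U))
  obtain ⟨w, hw, hwW⟩ := hW
  obtain ⟨Y', f', hf'⟩ := exists_specialHull_eq_range hF W
  obtain ⟨A, f, hwf, hff'⟩ := exists_special_of_mem_range hF φ f' (y := w) (by
    rw [hwW, ← hf']
    exact le_iff_gen_mem.mp (le_specialHull hF W))
  have hsub : Set.range (mor F (f ≫ ψ)) ⊆ Set.range (mor F ψ) := by
    rw [range_mor_comp]
    exact Set.image_subset_range _ _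
  -- Let T be the image of `f` and Q = ψ⁻¹(ψ(T)), the image of `g`. Then φ(Q) is special and
  -- contains U, φ(T) lies in ⟨W⟩, ψ(Q) = ψ(T), the fiber of Q over z gives ⟨U⟩_ws, and that of T
  -- contains a lift of the generic point of W.
  obtain ⟨B, g, hg⟩ := exists_range_eq_preimage hF ψ (f ≫ ψ) hirr hsub
  have hTQ : Set.range (mor F f) ⊆ Set.range (mor F g) := by
    rw [hg, range_mor_comp]
    exact Set.subset_preimage_image _ _
  have hgψ : Set.range (mor F (g ≫ ψ)) = Set.range (mor F (f ≫ ψ)) := by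
    rw [range_mor_comp, hg, Set.image_preimage_eq_of_subset hsub]
  have hzf : z ∈ Set.range (mor F (f ≫ ψ)) := by
    obtain ⟨s, rfl⟩ := hwf
    exact ⟨s, by rw [mor_comp]; exact hw⟩
  obtain ⟨s, -, hs⟩ := exists_specializes_isClosed (genericPoint (var F A))
  obtain ⟨s', hs'⟩ := hTQ ⟨s, rfl⟩
  set x := mor F (f ≫ φ) s with hx
  have hxcl : IsClosed {x} := isClosed_map _ hs
  have hxg : x ∈ Set.range (mor F (g ≫ φ)) := ⟨s', by rw [mor_comp, hs', hx, mor_comp]⟩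
  -- These two identities compare the drop from φ(Q) to ⟨U⟩_ws with that from φ(T) to the image of
  -- the fiber of T: both are dim ψ(T) minus the dimension of the ψ-image of a φ-fiber over the same
  -- `x`, which is larger for Q ⊇ T.
  have d1 := dim_image_fiber_add hF (g ≫ φ) (g ≫ ψ) hxcl hz hxg (by rw [hgψ]; exact hzf)
  have d2 := dim_image_fiber_add hF (f ≫ φ) (f ≫ ψ) hxcl hz ⟨s, rfl⟩ hzf
  have e1 : mor F (g ≫ φ) '' (mor F (g ≫ ψ) ⁻¹' {z}) = weaklySpecialHull U := by
    rw [hU]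
    apply subset_antisymm
    · rintro _ ⟨q, hq, rfl⟩
      exact ⟨mor F g q, by rw [Set.mem_preimage, ← mor_comp]; exact hq, (mor_comp _ _ _).symm⟩
    · rintro _ ⟨y, hy, rfl⟩
      have : y ∈ Set.range (mor F g) := by
        rw [hg, Set.mem_preimage, show mor F ψ y = z from hy]
        exact hzf
      obtain ⟨q, rfl⟩ := this
      exact ⟨q, by rw [Set.mem_preimage, mor_comp]; exact hy, mor_comp _ _ _⟩
  have i1 : dim (specialHull U : Set (var F X)) ≤ dim (Set.range (mor F (g ≫ φ))) := by
    refine dim_mono (specialHull U).isClosed (hF.isClosed_range _ _ _)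
      (specialHull U).isIrreducible.1 (specialHull_subset_range hF _ ?_)
    have : gen U ∈ (weaklySpecialHull U : Set (var F X)) :=
      le_iff_gen_mem.mp (le_weaklySpecialHull hF U)
    rw [← e1] at this
    exact Set.image_subset_range _ _ this
  have i2 : dim (weaklySpecialHull W : Set (var F X)) ≤
      dim (mor F (f ≫ φ) '' (mor F (f ≫ ψ) ⁻¹' {z})) := by
    refine dim_weaklySpecialHull_le hF _ _ hz ?_
    obtain ⟨q, rfl⟩ := hwf
    exact ⟨q, by rw [Set.mem_preimage, mor_comp]; exact hw, by rw [mor_comp, hwW]⟩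
  have i3 : dim (Set.range (mor F (f ≫ φ))) ≤ dim (specialHull W : Set (var F X)) := by
    refine dim_mono (hF.isClosed_range _ _ _) (specialHull W).isClosed ⟨x, s, rfl⟩ ?_
    rw [hf']
    exact hff'
  have i4 : dim (mor F (f ≫ ψ) '' (mor F (f ≫ φ) ⁻¹' {x})) ≤
      dim (mor F (g ≫ ψ) '' (mor F (g ≫ φ) ⁻¹' {x})) := by
    refine dim_mono (isClosed_image_fiber hF _ _ hxcl) (isClosed_image_fiber hF _ _ hxcl)
      ⟨_, s, rfl, rfl⟩ ?_
    rintro _ ⟨q, hq, rfl⟩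
    obtain ⟨q', hq'⟩ := hTQ ⟨q, rfl⟩
    refine ⟨q', ?_, by rw [mor_comp, hq', mor_comp]⟩
    rw [Set.mem_preimage, mor_comp, hq', ← mor_comp]
    exact hq
  rw [e1, hgψ] at d1
  simp only [defect, weakDefect]
  omega

theorem IsOptimal.isWeaklyOptimal (hF : IsDistinguished F) {W V : Subvar F X}
    (h : IsOptimal W V) : IsWeaklyOptimal W V := by
  refine ⟨h.1, fun U hWU hUV => ?_⟩
  have h1 := h.2 U hWU hUV
  have h2 := defect_sub_weakDefect_le hF hWU.le
  omega

end WeaklySpecial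

/-! ### The two implications between the formulations -/

section ZilberPink

variable {K : Type u} [Field K] {C : Type v} [Category.{w} C]
  {F : C ⥤ VarietyCat K} {X : C}

/-- Take W of maximal dimension among the subvarieties between U and V of defect at most δ(U). -/
theorem exists_isOptimal_ge {U V : Subvar F X} (hUV : U ≤ V) :
    ∃ W, U ≤ W ∧ IsOptimal W V ∧ defect W ≤ defect U := by
  have hbdd : BddAbove ((fun W : Subvar F X => dim (W : Set (var F X))) ''
      {W | U ≤ W ∧ W ≤ V ∧ defect W ≤ defect U}) := by
    refine ⟨dim (V : Set (var F X)), ?_⟩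
    rintro _ ⟨W, hW, rfl⟩
    exact dim_le_of_le hW.2.1
  obtain ⟨W, ⟨hUW, hWV, hd⟩, hmax⟩ := Nat.sSup_mem
    (Set.Nonempty.image _ (s := {W | U ≤ W ∧ W ≤ V ∧ defect W ≤ defect U})
      ⟨U, le_rfl, hUV, le_rfl⟩) hbdd
  refine ⟨W, hUW, ⟨hWV, fun W' hWW' hW'V => ?_⟩, hd⟩
  by_contra hle
  have h1 : dim (W' : Set (var F X)) ≤ dim (W : Set (var F X)) := by
    simp only at hmax
    rw [hmax]
    exact le_csSup hbdd ⟨W', ⟨hUW.trans hWW'.le, hW'V, (not_lt.mp hle).trans hd⟩, rfl⟩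
  have := dim_lt_of_lt hWW'
  omega

theorem mem_specialUnion_iff (hF : IsDistinguished F) {x : var F X} {k : ℤ} :
    x ∈ specialUnion F X ((dim (Set.univ : Set (var F X)) : ℤ) - k) ↔
      (dim (specialHull (ofPoint F x) : Set (var F X)) : ℤ) ≤ k := by
  simp only [specialUnion, Set.mem_iUnion, Set.mem_ofPred_eq, exists_prop]
  constructor
  · rintro ⟨S, ⟨hS, hk⟩, hx⟩
    have h1 : specialHull (ofPoint F x) ≤ S :=
      (isLeast_specialHull hF (ofPoint F x)).2 ⟨hS, ofPoint_le_iff.mpr hx⟩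
    have := dim_le_of_le h1
    omega
  · intro h
    exact ⟨_, ⟨(isLeast_specialHull hF (ofPoint F x)).1.1, by omega⟩,
      ofPoint_le_iff.mp (le_specialHull hF _)⟩

theorem PinkFormulation.of_zilberFormulation (hF : IsDistinguished F) {m d : ℕ}
    (h : ZilberFormulation F m d) : PinkFormulation F m d := by
  intro X V hV hdense
  have hfin := h X V hV
  let 𝒲 := {W : Subvar F X | (IsOptimal W V ∧ defect W ≤ d) ∧ W ≠ V}
  have hfin' : 𝒲.Finite := hfin.subset fun W hW => hW.1
  have hcl : IsClosed (⋃ W ∈ 𝒲, (W : Set (var F X))) :=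
    hfin'.isClosed_biUnion fun W _ => W.isClosed
  have hsub : (V : Set (var F X)) ⊆ ⋃ W ∈ 𝒲, (W : Set (var F X)) := by
    refine hdense.trans (hcl.closure_subset_iff.mpr ?_)
    rintro x ⟨hxV, hx⟩
    rw [mem_specialUnion_iff hF] at hx
    obtain ⟨W, hxW, hopt, hd⟩ := exists_isOptimal_ge (ofPoint_le_iff.mpr hxV)
    have h1 : defect (ofPoint F x) ≤ min (defect V - 1) d := by
      rw [defect]
      omega
    refine Set.mem_biUnion (x := W) ⟨⟨hopt, by omega⟩, ?_⟩ (ofPoint_le_iff.mp hxW)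
    rintro rfl
    omega
  have hgen := hsub (gen_mem V)
  simp only [Set.mem_iUnion, exists_prop] at hgen
  obtain ⟨W, hW, hVW⟩ := hgen
  exact hW.2 (hW.1.1.1.antisymm (le_iff_gen_mem.mpr hVW))

variable [IsAlgClosed K]

/-- A larger irreducible subset of V ∩ ⟨W⟩_ws would have larger dimension but no larger hull, hence
smaller weak defect. -/
theorem IsWeaklyOptimal.isComponentOf (hF : IsDistinguished F) {W V : Subvar F X}
    (h : IsWeaklyOptimal W V) :
    IsComponentOf (W : Set (var F X)) ((V : Set (var F X)) ∩ weaklySpecialHull W) := by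
  refine ⟨⟨W.isIrreducible, Set.subset_inter h.1 (le_weaklySpecialHull hF W)⟩, ?_⟩
  rintro U ⟨hU, hUS⟩ hWU
  let U' : Subvar F X := ⟨closure U, hU.closure, isClosed_closure⟩
  have hWU' : W ≤ U' := hWU.trans subset_closure
  have hU'V : U' ≤ V := V.isClosed.closure_subset_iff.mpr (hUS.trans Set.inter_subset_left)
  have hU'W : U' ≤ weaklySpecialHull W :=
    (weaklySpecialHull W).isClosed.closure_subset_iff.mpr (hUS.trans Set.inter_subset_right)
  have hUWd : dim (weaklySpecialHull U' : Set (var F X)) ≤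
      dim (weaklySpecialHull W : Set (var F X)) :=
    dim_le_of_le ((isLeast_weaklySpecialHull hF U').2 ⟨(isLeast_weaklySpecialHull hF W).1.1, hU'W⟩)
  rcases hWU'.eq_or_lt with heq | hlt
  · exact subset_closure.trans (show (U' : Set (var F X)) ⊆ W by rw [heq])
  · have h1 := h.2 U' hlt hU'V
    have h2 := dim_lt_of_lt hlt
    simp only [weakDefect] at h1
    omega

section Fibers

variable {Y Z : C} (φ : Y ⟶ X) (ψ : Y ⟶ Z)

theorem dim_image_fiber (hF : IsDistinguished F) (hφ : HasFiniteFibers (mor F φ)) {z : var F Z}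
    (hz : IsClosed {z}) (hzψ : z ∈ Set.range (mor F ψ)) :
    dim (mor F φ '' (mor F ψ ⁻¹' {z})) = dim (mor F ψ ⁻¹' {z}) := by
  obtain ⟨y₀, hy₀⟩ := hzψ
  apply le_antisymm
  · refine dim_le (isClosed_image_fiber hF φ ψ hz) ⟨_, y₀, hy₀, rfl⟩ ?_
    rintro _ ⟨y, hy, rfl⟩
    rw [ht_map_eq φ hφ]
    exact ht_le_dim (isClosed_preimage_singleton ψ hz) hy
  · refine dim_le (isClosed_preimage_singleton ψ hz) ⟨y₀, hy₀⟩ fun y hy => ?_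
    rw [← ht_map_eq φ hφ]
    exact ht_le_dim (isClosed_image_fiber hF φ ψ hz) ⟨y, hy, rfl⟩

/-- A special T in Y that maps into ⟨W⟩ and contains the generic point of the irreducible fiber
ψ⁻¹(z) contains the whole fiber. Hence dim T = dim ψ(T) + dim ψ⁻¹(z), and ψ(T) is special through z.
-/
theorem dim_specialHull_add_dim_weaklySpecialHull_le (hF : IsDistinguished F)
    (hφ : HasFiniteFibers (mor F φ))
    (hirr : ∀ z ∈ Set.range (mor F ψ), IsIrreducible (mor F ψ ⁻¹' {z})) {W : Subvar F X}
    {z : var F Z} (hz : IsClosed {z}) (hzψ : z ∈ Set.range (mor F ψ))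
    (hW : (weaklySpecialHull W : Set (var F X)) = mor F φ '' (mor F ψ ⁻¹' {z})) :
    dim (specialHull (ofPoint F z) : Set (var F Z)) + dim (weaklySpecialHull W : Set (var F X)) ≤
      dim (specialHull W : Set (var F X)) := by
  let E : Subvar F Y := ⟨mor F ψ ⁻¹' {z}, hirr z hzψ, isClosed_preimage_singleton ψ hz⟩
  have hE : (E : Set (var F Y)) = mor F ψ ⁻¹' {z} := rfl
  have hψE : mor F ψ (gen E) = z := gen_mem E
  obtain ⟨Y', f', hf'⟩ := exists_specialHull_eq_range hF W
  obtain ⟨A, f, hwf, hff'⟩ := exists_special_of_mem_range hF φ f' (y := gen E) (by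
    rw [← hf']
    refine weaklySpecialHull_le_specialHull hF W ?_
    change _ ∈ (weaklySpecialHull W : Set (var F X))
    rw [hW]
    exact ⟨_, gen_mem E, rfl⟩)
  have hET : mor F ψ ⁻¹' {z} ⊆ Set.range (mor F f) :=
    (subset_iff_gen_mem (V := E) (hF.isClosed_range _ _ _)).mpr hwf
  have hzf : z ∈ Set.range (mor F (f ≫ ψ)) := by
    rw [range_mor_comp]
    exact ⟨_, hwf, hψE⟩
  have d1 := dim_range_inter_fiber hF f ψ hz hzf
  rw [Set.inter_eq_right.mpr hET, ← dim_image_fiber φ ψ hF hφ hz hzψ, ← hW] at d1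
  have d2 : dim (specialHull (ofPoint F z) : Set (var F Z)) ≤ dim (Set.range (mor F (f ≫ ψ))) :=
    dim_mono (specialHull _).isClosed (hF.isClosed_range _ _ _) (specialHull _).isIrreducible.1
      (specialHull_subset_range hF _ (by rw [gen_ofPoint]; exact hzf))
  have d3 : dim (Set.range (mor F f)) ≤ dim (specialHull W : Set (var F X)) := by
    refine dim_le (hF.isClosed_range _ _ _) ⟨_, hwf⟩ ?_
    rintro _ ⟨s, rfl⟩
    rw [← ht_map_eq φ hφ]
    refine ht_le_dim (specialHull W).isClosed ?_
    rw [hf']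
    exact hff' ⟨s, by rw [mor_comp]⟩
  omega

/-- The ψ-preimage of ⟨ψ(x)⟩ is special of dimension dim ⟨ψ(x)⟩ + e, and its image under φ is a
special subvariety containing φ(x). -/
theorem dim_specialHull_map_le (hF : IsDistinguished F) {e : ℕ}
    (hirr : ∀ z ∈ Set.range (mor F ψ), IsIrreducible (mor F ψ ⁻¹' {z}))
    (he : ∀ z ∈ Set.range (mor F ψ), IsClosed {z} → dim (mor F ψ ⁻¹' {z}) = e) (x : var F Y) :
    dim (specialHull (ofPoint F (mor F φ x)) : Set (var F X)) ≤
      dim (specialHull (ofPoint F (mor F ψ x)) : Set (var F Z)) + e := by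
  set S := specialHull (ofPoint F (mor F ψ x)) with hS
  obtain ⟨B, f, hf⟩ := exists_specialHull_eq_range hF (ofPoint F (mor F ψ x))
  rw [← hS] at hf
  have hfψ : Set.range (mor F f) ⊆ Set.range (mor F ψ) := by
    rw [← hf]
    exact specialHull_subset_range hF ψ (by rw [gen_ofPoint]; exact ⟨x, rfl⟩)
  obtain ⟨A, a, ha⟩ := exists_range_eq_preimage hF ψ f hirr hfψ
  have hxS : mor F ψ x ∈ (S : Set (var F Z)) := ofPoint_le_iff.mp (le_specialHull hF _)
  have hxa : x ∈ Set.range (mor F a) := by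
    rw [ha, ← hf]
    exact hxS
  obtain ⟨e', he', hdim⟩ := dim_preimage_of_subset_range hF ψ
  obtain ⟨y, -, hy⟩ := exists_specializes_isClosed x
  have hee' : e' = e := by
    rw [← he' _ ⟨y, rfl⟩ (isClosed_map ψ hy), ← he _ ⟨y, rfl⟩ (isClosed_map ψ hy)]
  have h1 := hdim S S.isClosed S.isIrreducible.1 (by rw [hf]; exact hfψ)
  rw [← hee', ← h1, hf, ← ha]
  refine dim_le (specialHull _).isClosed (specialHull _).isIrreducible.1 fun q hq => ?_
  have hq' : q ∈ Set.range (mor F (a ≫ φ)) := by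
    refine specialHull_subset_range hF (a ≫ φ) ?_ hq
    rw [gen_ofPoint, range_mor_comp]
    exact ⟨x, hxa, rfl⟩
  rw [range_mor_comp] at hq'
  obtain ⟨p, hp, rfl⟩ := hq'
  exact (ht_map_le φ p).trans (ht_le_dim (hF.isClosed_range _ _ _) hp)

/-- The heart of the implication from Pink to Zilber: infinitely many parameters z would accumulate
along some v, and the corresponding W would sweep out a larger subvariety of V of no larger defect.
-/
theorem finite_setOf_weaklySpecialHull_eq (hF : IsDistinguished F) {m d : ℕ}
    (h : PinkFormulation F m d) (hφ : HasFiniteFibers (mor F φ))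
    (hirr : ∀ z ∈ Set.range (mor F ψ), IsIrreducible (mor F ψ ⁻¹' {z})) {V : Subvar F X}
    (hV : dim (V : Set (var F X)) ≤ m) (k : ℕ) :
    {z : var F Z | z ∈ Set.range (mor F ψ) ∧ IsClosed {z} ∧ ∃ W : Subvar F X, IsOptimal W V ∧
      defect W ≤ d ∧ dim (W : Set (var F X)) = k ∧
      (weaklySpecialHull W : Set (var F X)) = mor F φ '' (mor F ψ ⁻¹' {z})}.Finite := by
  by_contra hinf
  set Zs := {z : var F Z | z ∈ Set.range (mor F ψ) ∧ IsClosed {z} ∧ ∃ W : Subvar F X,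
    IsOptimal W V ∧ defect W ≤ d ∧ dim (W : Set (var F X)) = k ∧
    (weaklySpecialHull W : Set (var F X)) = mor F φ '' (mor F ψ ⁻¹' {z})} with hZs
  obtain ⟨v, hvcl, hv⟩ := exists_mem_closure_of_infinite hinf
  obtain ⟨e, he⟩ := exists_dim_fiber_eq hF ψ
  have hdimz : ∀ z ∈ Set.range (mor F ψ), IsClosed {z} → ∀ W : Subvar F X,
      (weaklySpecialHull W : Set (var F X)) = mor F φ '' (mor F ψ ⁻¹' {z}) →
      dim (specialHull (ofPoint F z) : Set (var F Z)) + e ≤ dim (specialHull W : Set (var F X)) ∧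
      dim (W : Set (var F X)) ≤ e := by
    intro z hzψ hz W hW
    have h1 := dim_specialHull_add_dim_weaklySpecialHull_le φ ψ hF hφ hirr hz hzψ hW
    have h2 : dim (weaklySpecialHull W : Set (var F X)) = e := by
      rw [hW, dim_image_fiber φ ψ hF hφ hz hzψ, he z hzψ hz]
    have h3 := dim_le_of_le (le_weaklySpecialHull hF W)
    omega
  have hM : IsClosed (mor F φ ⁻¹' (V : Set (var F X))) := V.isClosed.preimage (continuous_mor φ)
  -- Needed twice: with all parameters, to bound dim v by m so that Pink's statement applies, and
  -- with the subset `D'` it leaves, to produce a contradiction.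
  have lift : ∀ D' ⊆ Zs ∩ closure {v}, v ∈ closure D' →
      ∃ x, mor F φ x ∈ (V : Set (var F X)) ∧ mor F ψ x = v ∧ ht v + k ≤ ht x ∧
        ∃ w, x ⤳ w ∧ mor F ψ w ∈ D' ∧ ∃ W : Subvar F X, mor F φ w = gen W ∧ IsOptimal W V ∧
          dim (W : Set (var F X)) = k ∧
          (weaklySpecialHull W : Set (var F X)) = mor F φ '' (mor F ψ ⁻¹' {mor F ψ w}) := by
    intro D' hD' hvD'
    obtain ⟨x, hxM, hx, ⟨w, hw, hxw⟩, hht⟩ := exists_ht_add_le ψ ⟨_, hM⟩ v k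
      {w | mor F ψ w ∈ D' ∧ ∃ W : Subvar F X, mor F φ w = gen W ∧ IsOptimal W V ∧
        dim (W : Set (var F X)) = k ∧
        (weaklySpecialHull W : Set (var F X)) = mor F φ '' (mor F ψ ⁻¹' {mor F ψ w})}
      (by
        rintro w ⟨-, W, hwW, hopt, -, -⟩
        change mor F φ w ∈ (V : Set (var F X))
        rw [hwW]
        exact hopt.1 (gen_mem W))
      (fun w hw => (hD' hw.1).1.2.1)
      (by
        rintro w ⟨-, W, hwW, -, hk, -⟩
        rw [← ht_map_eq φ hφ, hwW, ← dim_eq_ht_gen, hk])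
      (fun w hw => specializes_iff_mem_closure.mpr (hD' hw.1).2)
      (by
        refine closure_mono ?_ hvD'
        intro z hz
        obtain ⟨-, -, W, hopt, -, hk, hW⟩ := (hD' hz).1
        have hgW : gen W ∈ (weaklySpecialHull W : Set (var F X)) :=
          le_iff_gen_mem.mp (le_weaklySpecialHull hF W)
        rw [hW] at hgW
        obtain ⟨w, hwz, hwW⟩ := hgW
        have hwz' : mor F ψ w = z := hwz
        exact ⟨w, ⟨by rw [hwz']; exact hz, W, hwW, hopt, hk, by rw [hwz']; exact hW⟩, hwz'⟩)
    exact ⟨x, hxM, hx, hht, w, hxw, hw⟩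
  have hvm : dim (ofPoint F v : Set (var F Z)) ≤ m := by
    obtain ⟨x, hxV, -, hht, -⟩ := lift _ subset_rfl hv
    have h1 := ht_le_dim V.isClosed hxV
    rw [ht_map_eq φ hφ] at h1
    rw [dim_eq_ht_gen, gen_ofPoint]
    omega
  have hpink := h Z (ofPoint F v) hvm
  let D' := {z | z ∈ Zs ∩ closure {v} ∧
    defect (ofPoint F v) ≤ dim (specialHull (ofPoint F z) : Set (var F Z))}
  -- Parameters outside `D'` have special hull of dimension at most δ(v) - 1, and at most d since k
  -- ≤ e. They lie in Pink's exceptional set, so they are not dense.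
  have hvD' : v ∈ closure D' := by
    by_contra hvD'
    refine hpink ?_
    rw [subset_iff_gen_mem isClosed_closure, gen_ofPoint]
    have hcover : Zs ∩ closure {v} ⊆ D' ∪ (Zs ∩ closure {v}) \ D' := by
      rw [Set.union_sdiff_self]
      exact Set.subset_union_right
    have h1 := closure_mono hcover hv
    rw [closure_union] at h1
    refine closure_mono ?_ (h1.resolve_left hvD')
    rintro z ⟨hz, hzD'⟩
    refine ⟨hz.2, ?_⟩
    rw [mem_specialUnion_iff hF, le_min_iff]
    constructor
    · have : ¬ defect (ofPoint F v) ≤ dim (specialHull (ofPoint F z) : Set (var F Z)) :=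
        fun hle => hzD' ⟨hz, hle⟩
      omega
    · obtain ⟨hzψ, hzcl, W, -, hWd, -, hW⟩ := hz.1
      have h2 := hdimz z hzψ hzcl W hW
      rw [defect] at hWd
      omega
  obtain ⟨x, hxV, hxv, hht, w, hxw, hwD', W, hwW, hopt, hk, hW⟩ := lift D' (fun z hz => hz.1) hvD'
  obtain ⟨hwψ, hwcl, -⟩ := hwD'.1.1
  have hWx : W ≤ ofPoint F (mor F φ x) := by
    rw [le_iff_gen_mem, ← hwW]
    exact specializes_iff_mem_closure.mp (hxw.map (continuous_mor φ))
  have hdx := dim_specialHull_map_le φ ψ hF hirr he x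
  have hdw := (hdimz _ hwψ hwcl W hW).1
  have hdv := hwD'.2
  rw [hxv] at hdx
  have hdimx : dim (ofPoint F (mor F φ x) : Set (var F X)) = ht x := by
    rw [dim_eq_ht_gen, gen_ofPoint, ht_map_eq φ hφ]
  -- Equality would force dim v = 0, but `v` is not closed. Otherwise the closure of φ(x) is a
  -- strictly larger subvariety of V with defect at most δ(W).
  rcases hWx.eq_or_lt with heq | hlt
  · rw [← heq, hk] at hdimx
    exact hvcl (ht_eq_zero_iff.mp (by omega))
  · have h1 := hopt.2 _ hlt (ofPoint_le_iff.mpr hxV)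
    rw [defect, dim_eq_ht_gen (ofPoint F v), gen_ofPoint] at hdv
    rw [defect, defect, hdimx, hk] at h1
    omega

/-- After passing to irreducible fibers, finitely many pairs (k, z) occur, and each W is one of the
finitely many components of V ∩ ⟨W⟩_ws. -/
theorem finite_setOf_isOptimal_of_presentation (hF : IsDistinguished F) {m d : ℕ}
    (h : PinkFormulation F m d) (hφ : HasFiniteFibers (mor F φ)) {V : Subvar F X}
    (hV : dim (V : Set (var F X)) ≤ m) :
    {W : Subvar F X | IsOptimal W V ∧ defect W ≤ d ∧ ∃ z ∈ closedPoints (var F Z),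
      IsComponentOf (weaklySpecialHull W : Set (var F X))
        (mor F φ '' (mor F ψ ⁻¹' {z}))}.Finite := by
  obtain ⟨Y', Z', φ₁, ψ', hφ₁, hirr, hpres⟩ := exists_irreducible_presentation hF ψ
  have hΦ : HasFiniteFibers (mor F (φ₁ ≫ φ)) := hφ₁.comp_mor hφ
  let Zs (k : ℕ) := {z : var F Z' | z ∈ Set.range (mor F ψ') ∧ IsClosed {z} ∧
    ∃ W : Subvar F X, IsOptimal W V ∧ defect W ≤ d ∧ dim (W : Set (var F X)) = k ∧
      (weaklySpecialHull W : Set (var F X)) = mor F (φ₁ ≫ φ) '' (mor F ψ' ⁻¹' {z})}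
  have hZs : ∀ k, (Zs k).Finite :=
    finite_setOf_weaklySpecialHull_eq (φ₁ ≫ φ) ψ' hF h hΦ hirr hV
  have hfin : (⋃ k ∈ Set.Iic (dim (V : Set (var F X))), ⋃ z ∈ Zs k,
      {W : Subvar F X | IsComponentOf (W : Set (var F X))
        (V ∩ mor F (φ₁ ≫ φ) '' (mor F ψ' ⁻¹' {z}))}).Finite :=
    (Set.finite_Iic _).biUnion fun k _ => (hZs k).biUnion fun z hz =>
      finite_isComponentOf (V.isClosed.inter (isClosed_image_fiber hF _ _ hz.2.1))
  refine hfin.subset ?_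
  rintro W ⟨hopt, hd, z, hz, hcomp⟩
  obtain ⟨z', hz'ψ, hz', heq⟩ := hpres X φ z _ hz hcomp
  refine Set.mem_biUnion (x := dim (W : Set (var F X))) (dim_le_of_le hopt.1)
    (Set.mem_biUnion (x := z') ⟨hz'ψ, hz', W, hopt, hd, rfl, heq⟩ ?_)
  rw [Set.mem_ofPred_eq, ← heq]
  exact (hopt.isWeaklyOptimal hF).isComponentOf hF

end Fibers

theorem ZilberFormulation.of_pinkFormulation (hF : IsDistinguished F) (hA5 : WeakFiniteness F)
    {m d : ℕ} (h : PinkFormulation F m d) : ZilberFormulation F m d := by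
  intro X V hV
  obtain ⟨n, Y, Z, φ, ψ, hcov⟩ := hA5 X V
  have hfin : (⋃ i, {W : Subvar F X | HasFiniteFibers (mor F (φ i)) ∧
      IsOptimal W V ∧ defect W ≤ d ∧ ∃ z ∈ closedPoints (var F (Z i)),
        IsComponentOf (weaklySpecialHull W : Set (var F X))
          (mor F (φ i) '' (mor F (ψ i) ⁻¹' {z}))}).Finite := by
    refine Set.finite_iUnion fun i => ?_
    by_cases hφ : HasFiniteFibers (mor F (φ i))
    · exact (finite_setOf_isOptimal_of_presentation (φ i) (ψ i) hF h hφ hV).subset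
        fun W hW => hW.2
    · exact Set.finite_empty.subset fun W hW => hφ hW.1
  refine hfin.subset ?_
  rintro W ⟨hopt, hd⟩
  obtain ⟨i, hφ, hz⟩ := hcov W (hopt.isWeaklyOptimal hF)
  exact Set.mem_iUnion.mpr ⟨i, hφ, hopt, hd, hz⟩

end ZilberPink

end UnlikelyIntersections

end

theorem mainTheorem7 {K : Type u} [Field K] [IsAlgClosed K] [CharZero K]
    {C : Type v} [CategoryTheory.Category.{w} C] (F : C ⥤ UnlikelyIntersections.VarietyCat K)
    (hF : UnlikelyIntersections.IsDistinguished F)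
    (hA5 : UnlikelyIntersections.WeakFiniteness F) (m d : ℕ) :
    UnlikelyIntersections.ZilberFormulation F m d ↔
      UnlikelyIntersections.PinkFormulation F m d :=
  ⟨UnlikelyIntersections.PinkFormulation.of_zilberFormulation hF,
    UnlikelyIntersections.ZilberFormulation.of_pinkFormulation hF hA5⟩
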